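/- Let $p,q\in\mathbb C$ (in particular, $p,q$ may be real). Consider the quadratic differential system \[ \dot z=zy+1,\qquad \dot y=3y^2-\tfrac{8}{13}\,q\,zy-\tfrac{24}{169}\,q^2z^2+q , \] and the polynomial $g\in\mathbb C[z,y]$ \[ \begin{aligned} g&=\;\tfrac{16777216}{23298085122481}q^{12}z^{18} - \tfrac{50331648}{1792160394037}q^{11}z^{16}\\ &\quad + \tfrac{12582912}{137858491849}q^{10}yz^{15} + \tfrac{60555264}{137858491849}q^{10}z^{14}\\ &\quad - \tfrac{26738688}{10604499373}q^{9}yz^{13} + \bigl(\tfrac{3342336}{815730721}q^{8}y^{2}\\ &\quad - \tfrac{2818048}{815730721}q^{9}\bigr)z^{12} + \tfrac{20840448}{815730721}q^{8}yz^{11}\\ &\quad + \bigl(-\tfrac{4325376}{62748517}q^{7}y^{2} + \tfrac{11452416}{815730721}q^{8}\\ &\quad - \tfrac{1728}{4826809}pq^{6}\bigr)z^{10} + \bigl(\tfrac{360448}{4826809}q^{6}y^{3}\\ &\quad - \tfrac{540672}{4826809}q^{7}y\bigr)z^{9} + \bigl(\tfrac{1695744}{4826809}q^{6}y^{2}\\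 &\quad + \tfrac{288}{28561}pq^{4}y^{2} - \tfrac{1744896}{62748517}q^{7} + \tfrac{2592}{371293}pq^{5}\bigr)z^{8}\\ &\quad + \bigl(-\tfrac{196608}{371293}q^{5}y^{3} - \tfrac{64}{2197}pq^{3}y^{3} + \tfrac{964608}{4826809}q^{6}y\\ &\quad - \tfrac{720}{28561}pq^{4}y\bigr)z^{7} + \bigl(\tfrac{12288}{28561}q^{4}y^{4} + \tfrac{4}{169}pq^{2}y^{4}\\ &\quad - \tfrac{196608}{371293}q^{5}y^{2} - \tfrac{264}{2197}pq^{3}y^{2} + \tfrac{132544}{4826809}q^{6}\\ &\quad - \tfrac{90}{2197}pq^{4}\bigr)z^{6} + \bigl(\tfrac{18432}{28561}q^{4}y^{3} + \tfrac{136}{169}pq^{2}y^{3}\\ &\quad - \tfrac{59136}{371293}q^{5}y + \tfrac{474}{2197}pq^{3}y\bigr)z^{5} + \bigl(-\tfrac{20}{13}pqy^{4}\\ &\quad + \tfrac{10896}{28561}q^{4}y^{2} - \tfrac{69}{338}pq^{2}y^{2} - \tfrac{5712}{371293}q^{5}\\ &\quad + \tfrac{241}{4394}pq^{3}\bigr)z^{4}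 + \bigl(py^{5} - \tfrac{608}{2197}q^{3}y^{3} - \tfrac{1}{2}pqy^{3}\\ &\quad + \tfrac{1104}{28561}q^{4}y - \tfrac{11}{52}pq^{2}y\bigr)z^{3} + \bigl(\tfrac{204}{169}q^{2}y^{4}\\ &\quad + \tfrac{3}{4}py^{4} + \tfrac{1224}{2197}q^{3}y^{2} + \tfrac{3}{26}pqy^{2} + \tfrac{177}{2197}q^{4}\\ &\quad - \tfrac{23}{832}pq^{2}\bigr)z^{2} + \bigl(-\tfrac{24}{13}qy^{5} - \tfrac{180}{169}q^{2}y^{3}\\ &\quad + \tfrac{3}{16}py^{3} - \tfrac{354}{2197}q^{3}y + \tfrac{23}{416}pqy\bigr)z + y^{6} + \tfrac{9}{13}qy^{4}\\ &\quad + \tfrac{24}{169}q^{2}y^{2} + \tfrac{1}{64}py^{2} + \tfrac{15}{2197}q^{3} + \tfrac{1}{208}pq. \end{aligned} \] Then $g=0$ is an invariant algebraic curve of the system with cofactor $K=18y$, that is, \[ (zy+1)\,\frac{\partial g}{\partial z}+\Bigl(3y^2-\tfrac{8}{13}qzy-\tfrac{24}{169}q^2z^2+q\Bigr)\frac{\partial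 g}{\partial y}=18\,y\,g . \] If $q\neq0$, then $g$ has degree eighteen. If moreover $p\neq-\tfrac{240}{169}q^2$ and $p\neq\tfrac{192}{169}q^2$, then $g$ is irreducible over $\mathbb C$ and the curve $g=0$ has (geometric) genus two. -/

import Mathlib

open MvPolynomial KaehlerDifferential

noncomputable section

namespace QuadraticSystem

/-- The planar polynomial system `ż = P(z,y)`, `ẏ = Q(z,y)` is quadratic. -/
def IsQuadratic (P Q : MvPolynomial (Fin 2) ℂ) : Prop :=
  max P.totalDegree Q.totalDegree = 2

/-- `g = 0` is invariant under the system `ż = P`, `ẏ = Q`, with cofactor `K`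
(the variable `z` is `X 0`, the variable `y` is `X 1`). -/
def IsInvariantWithCofactor (P Q g K : MvPolynomial (Fin 2) ℂ) : Prop :=
  P * pderiv 0 g + Q * pderiv 1 g = K * g

/-- The differentials of a field `K` over a subfield `k` that are regular at every place, that is,
at every valuation ring `O` with `k ⊆ O ⊆ K`: they come from `Ω[O⁄k]`. For a function field in one
variable these are the global regular differentials of its smooth projective model. -/
def regularDifferentials (k K : Type*) [Field k] [Field K] [Algebra k K] :
    Submodule k (Ω[K⁄k]) :=
  ⨅ (O : Subalgebra k K) (_ : ∀ x : K, x ∈ O ∨ x⁻¹ ∈ O),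
    (LinearMap.range (KaehlerDifferential.map k k O K)).restrictScalars k

theorem isPrime_of_irreducible {g : MvPolynomial (Fin 2) ℂ} (hg : Irreducible g) :
    (Ideal.span {g}).IsPrime :=
  (Ideal.span_singleton_prime hg.ne_zero).mpr hg.prime

/-- The (geometric) genus of the irreducible complex plane curve `g = 0`: the dimension of the
space of regular differentials of its function field. -/
def planeCurveGenus (g : MvPolynomial (Fin 2) ℂ) (hg : Irreducible g) : ℕ :=
  haveI : (Ideal.span {g}).IsPrime := isPrime_of_irreducible hg
  Module.finrank ℂ
    (regularDifferentials ℂ (FractionRing (MvPolynomial (Fin 2) ℂ ⧸ Ideal.span {g})))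

/-- The coordinate `z`. -/
abbrev z : MvPolynomial (Fin 2) ℂ := X 0

/-- The coordinate `y`. -/
abbrev y : MvPolynomial (Fin 2) ℂ := X 1

/-- The right-hand side of `ż = zy + 1`. -/
def fieldZ : MvPolynomial (Fin 2) ℂ := z * y + 1

/-- The right-hand side of `ẏ = 3y² - (8/13) q z y - (24/169) q² z² + q`. -/
def fieldY (q : ℂ) : MvPolynomial (Fin 2) ℂ :=
  3 * y ^ 2 - C (8 / 13 * q) * z * y - C (24 / 169 * q ^ 2) * z ^ 2 + C q

/-- The polynomial `g` of the curve of degree eighteen, with parameters `p` and `q`. -/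
def curve (p q : ℂ) : MvPolynomial (Fin 2) ℂ :=
  (C (16777216 / 23298085122481 * q ^ 12)) * z ^ 18
    + (-C (50331648 / 1792160394037 * q ^ 11)) * z ^ 16
    + (C (12582912 / 137858491849 * q ^ 10) * y) * z ^ 15
    + (C (60555264 / 137858491849 * q ^ 10)) * z ^ 14
    + (-C (26738688 / 10604499373 * q ^ 9) * y) * z ^ 13
    + (C (3342336 / 815730721 * q ^ 8) * y ^ 2 - C (2818048 / 815730721 * q ^ 9)) * z ^ 12
    + (C (20840448 / 815730721 * q ^ 8) * y) * z ^ 11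
    + (-C (4325376 / 62748517 * q ^ 7) * y ^ 2 + C (11452416 / 815730721 * q ^ 8)
      - C (1728 / 4826809 * p * q ^ 6)) * z ^ 10
    + (C (360448 / 4826809 * q ^ 6) * y ^ 3 - C (540672 / 4826809 * q ^ 7) * y) * z ^ 9
    + (C (1695744 / 4826809 * q ^ 6) * y ^ 2 + C (288 / 28561 * p * q ^ 4) * y ^ 2
      - C (1744896 / 62748517 * q ^ 7) + C (2592 / 371293 * p * q ^ 5)) * z ^ 8
    + (-C (196608 / 371293 * q ^ 5) * y ^ 3 - C (64 / 2197 * p * q ^ 3) * y ^ 3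
      + C (964608 / 4826809 * q ^ 6) * y - C (720 / 28561 * p * q ^ 4) * y) * z ^ 7
    + (C (12288 / 28561 * q ^ 4) * y ^ 4 + C (4 / 169 * p * q ^ 2) * y ^ 4
      - C (196608 / 371293 * q ^ 5) * y ^ 2 - C (264 / 2197 * p * q ^ 3) * y ^ 2
      + C (132544 / 4826809 * q ^ 6) - C (90 / 2197 * p * q ^ 4)) * z ^ 6
    + (C (18432 / 28561 * q ^ 4) * y ^ 3 + C (136 / 169 * p * q ^ 2) * y ^ 3
      - C (59136 / 371293 * q ^ 5) * y + C (474 / 2197 * p * q ^ 3) * y) * z ^ 5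
    + (-C (20 / 13 * p * q) * y ^ 4 + C (10896 / 28561 * q ^ 4) * y ^ 2
      - C (69 / 338 * p * q ^ 2) * y ^ 2 - C (5712 / 371293 * q ^ 5)
      + C (241 / 4394 * p * q ^ 3)) * z ^ 4
    + (C p * y ^ 5 - C (608 / 2197 * q ^ 3) * y ^ 3 - C (1 / 2 * p * q) * y ^ 3
      + C (1104 / 28561 * q ^ 4) * y - C (11 / 52 * p * q ^ 2) * y) * z ^ 3
    + (C (204 / 169 * q ^ 2) * y ^ 4 + C (3 / 4 * p) * y ^ 4
      + C (1224 / 2197 * q ^ 3) * y ^ 2 + C (3 / 26 * p * q) * y ^ 2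
      + C (177 / 2197 * q ^ 4) - C (23 / 832 * p * q ^ 2)) * z ^ 2
    + (-C (24 / 13 * q) * y ^ 5 - C (180 / 169 * q ^ 2) * y ^ 3 + C (3 / 16 * p) * y ^ 3
      - C (354 / 2197 * q ^ 3) * y + C (23 / 416 * p * q) * y) * z
    + (y ^ 6 + C (9 / 13 * q) * y ^ 4 + C (24 / 169 * q ^ 2) * y ^ 2
      + C (1 / 64 * p) * y ^ 2 + C (15 / 2197 * q ^ 3) + C (1 / 208 * p * q))

end QuadraticSystem

end

/-! Put r = q/13 = l². The curve belongs to the pencil spanned by B³ and A² (`eval_curve`), where B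
= `formB` has degree 2 in y and A = `formA` has degree 3. Weighted scaling reduces A and B to r = 1.
The member attached to p is then parametrized by the hyperelliptic curve v² = Δ(u), with Δ = `branch
c` a sextic and c a root of a quadratic equation depending on p and l. Indeed, along this
parametrization A²/B³ is the constant ((c-1)/(c+1))² (`formB_param`, `formA_param`). The two
excluded values of p are those giving c = 1 and c = -1; otherwise Δ is separable
(`separable_branch`).

Irreducibility: g is monic of degree 6 in y, and the parametrization has six distinct points over z
= 0 (`exists_finset_fibre`). Hence y satisfies no equation of smaller degree over ℂ[z], and g
generates the vanishing ideal of the parametrization (`dvd_of_aeval_eq_zero`), which is prime.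

Genus: u and v are rational functions of z and y (`mem_of_param_mem`), so the function field of g =
0 is ℂ(u, v). Its regular differentials have basis du/v, u du/v (`finrank_regularDifferentials`).
These two are regular by a Bézout identity for Δ and Δ'; that there are no others is seen by pulling
back along Laurent parametrizations. Invariance and the degree are direct computations. -/

open scoped LaurentSeries PowerSeries

/-! ### Laurent series: derivation, valuation ring, square roots. -/

namespace LaurentSeries

/-- The coefficient algebra structure, preferred to the one that factors through power series. -/
noncomputable instance instAlgebraCoefficients (k : Type*) [CommSemiring k] : Algebra k k⸨X⸩ :=
  HahnSeries.instAlgebra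

variable {k : Type*} [Field k]

theorem derivative_coeff (f : k⸨X⸩) (n : ℤ) :
    (derivative k f).coeff n = (n + 1) * f.coeff (n + 1) := by
  rw [derivative_apply, hasseDeriv_coeff]
  simp

theorem derivative_single_mul (n : ℤ) (f : k⸨X⸩) :
    derivative k (HahnSeries.single n 1 * f) =
      HahnSeries.single n 1 * derivative k f + HahnSeries.single (n - 1) (n : k) * f := by
  ext m
  rw [derivative_coeff, HahnSeries.coeff_add, HahnSeries.coeff_single_mul,
    HahnSeries.coeff_single_mul, HahnSeries.coeff_single_mul, derivative_coeff,
    show m + 1 - n = m - n + 1 by ring, show m - (n - 1) = m - n + 1 by ring]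
  push_cast
  ring

theorem derivative_coe (f : k⟦X⟧) :
    derivative k (f : k⸨X⸩) = ((PowerSeries.derivative k f : k⟦X⟧) : k⸨X⸩) := by
  ext m
  rw [derivative_coeff]
  rcases lt_trichotomy m (-1) with h | h | h
  · rw [PowerSeries.coeff_coe, PowerSeries.coeff_coe, if_pos (by omega), if_pos (by omega), mul_zero]
  · subst h
    rw [PowerSeries.coeff_coe, PowerSeries.coeff_coe]
    simp
  · lift m to ℕ using by omega
    rw [← Nat.cast_succ, coeff_coe_powerSeries, coeff_coe_powerSeries, PowerSeries.coeff_derivative]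
    push_cast
    ring

/-- Every Laurent series is a power of t times a power series, so the Leibniz rule reduces to the
one for power series. -/
theorem derivative_mul (f g : k⸨X⸩) :
    derivative k (f * g) = f * derivative k g + g * derivative k f := by
  rw [← single_order_mul_powerSeriesPart f, ← single_order_mul_powerSeriesPart g]
  generalize f.order = n
  generalize g.order = m
  generalize f.powerSeriesPart = F
  generalize g.powerSeriesPart = G
  have h : (HahnSeries.single n (1 : k) * (F : k⸨X⸩)) * (HahnSeries.single m 1 * (G : k⸨X⸩)) =
      HahnSeries.single (n + m) 1 * ((F * G : k⟦X⟧) : k⸨X⸩) := by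
    rw [PowerSeries.coe_mul, ← one_mul (1 : k), ← HahnSeries.single_mul_single]
    simp only [one_mul]; ring
  have h1 : HahnSeries.single (n + m - 1) ((n + m : ℤ) : k) =
      HahnSeries.single n (1 : k) * HahnSeries.single (m - 1) (m : k) +
      HahnSeries.single m (1 : k) * HahnSeries.single (n - 1) (n : k) := by
    rw [HahnSeries.single_mul_single, HahnSeries.single_mul_single,
      show n + (m - 1) = n + m - 1 by ring, show m + (n - 1) = n + m - 1 by ring,
      ← HahnSeries.single_add]
    push_cast
    ring_nf
  have h2 : HahnSeries.single (n + m) (1 : k) =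
      HahnSeries.single n (1 : k) * HahnSeries.single m (1 : k) := by
    rw [HahnSeries.single_mul_single, one_mul]
  rw [h, derivative_single_mul, derivative_single_mul, derivative_single_mul, derivative_coe,
    derivative_coe, derivative_coe, Derivation.leibniz, h1, h2]
  simp only [smul_eq_mul, PowerSeries.coe_mul, PowerSeries.coe_add]
  ring

/-- Differentiation of Laurent series as a derivation. -/
noncomputable def derivation (k : Type*) [Field k] : Derivation k k⸨X⸩ k⸨X⸩ :=
  Derivation.mk' (derivative k) fun f g => derivative_mul f g

/-- The root is the binomial series of exponent 1/2, rescaled by a, with X replaced by X². The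
square of X appears because the local parameters used below are functions of t². -/
theorem exists_sq_eq_one_add (a : ℂ) : ∃ s : ℂ⟦X⟧, s ^ 2 = 1 + PowerSeries.C a * PowerSeries.X ^ 2 := by
  let b : ℂ⟦X⟧ := PowerSeries.binomialSeries ℂ (1 / 2 : ℚ)
  have hb : b ^ 2 = 1 + PowerSeries.X := by
    have := PowerSeries.binomialSeries_nat (R := ℚ) (A := ℂ) 1
    rw [pow_one] at this
    rw [← this, sq, ← PowerSeries.binomialSeries_add]
    norm_num
  refine ⟨PowerSeries.expand 2 two_ne_zero (PowerSeries.rescale a b), ?_⟩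
  rw [← map_pow, ← map_pow, hb]
  rw [map_add, map_add, map_one, map_one, PowerSeries.rescale_X, map_mul, PowerSeries.expand_X]
  congr 2
  exact PowerSeries.expand_C _ _ _

theorem algebraMap_eq_coe (r : ℂ) :
    algebraMap ℂ ℂ⸨X⸩ r = ((PowerSeries.C r : ℂ⟦X⟧) : ℂ⸨X⸩) := by
  rw [PowerSeries.coe_C]; rfl

/-- The ring of power series inside the field of Laurent series. -/
noncomputable def integers : Subalgebra ℂ ℂ⸨X⸩ where
  __ := (HahnSeries.ofPowerSeries ℤ ℂ).range
  algebraMap_mem' r := ⟨PowerSeries.C r, (algebraMap_eq_coe r).symm⟩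

theorem mem_integers {f : ℂ⸨X⸩} : f ∈ integers ↔ ∃ F : ℂ⟦X⟧, (F : ℂ⸨X⸩) = f := Iff.rfl

theorem mem_integers_or_inv (f : ℂ⸨X⸩) : f ∈ integers ∨ f⁻¹ ∈ integers := by
  rw [mem_integers, mem_integers]
  have h := fun g : ℂ⸨X⸩ => val_le_one_iff_eq_coe ℂ g
  rw [← h, ← h, map_inv₀]
  rcases le_total (Valued.v f : WithZero (Multiplicative ℤ)) 1 with h1 | h1
  · exact Or.inl h1
  · exact Or.inr (inv_le_one_of_one_le₀ h1)

theorem derivative_mem_integers {f : ℂ⸨X⸩} (hf : f ∈ integers) : derivation ℂ f ∈ integers := by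
  obtain ⟨F, rfl⟩ := hf
  exact ⟨_, (derivative_coe F).symm⟩

theorem order_nonneg_of_mem_integers {f : ℂ⸨X⸩} (hf : f ∈ integers) : 0 ≤ f.order := by
  obtain ⟨F, rfl⟩ := hf
  by_contra! h
  have h0 : HahnSeries.ofPowerSeries ℤ ℂ F ≠ 0 := by
    intro h0
    rw [h0, HahnSeries.order_zero] at h
    exact lt_irrefl _ h
  have := PowerSeries.coeff_coe F (HahnSeries.ofPowerSeries ℤ ℂ F).order
  rw [if_pos h] at this
  exact HahnSeries.coeff_order_eq_zero.not.mpr h0 this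

theorem mem_integers_of_sq {f : ℂ⸨X⸩} (hf : f ^ 2 ∈ integers) : f ∈ integers := by
  rcases mem_integers_or_inv f with h | h
  · exact h
  · by_cases h0 : f = 0
    · rw [h0]; exact zero_mem _
    · have : f = f ^ 2 * f⁻¹ := by field_simp
      rw [this]
      exact mul_mem hf h

theorem exists_sq_eq_coe (a b : ℂ) (ha : a ≠ 0) :
    IsSquare ((PowerSeries.C a + PowerSeries.C b * PowerSeries.X ^ 2 : ℂ⟦X⟧)) := by
  obtain ⟨s, hs⟩ := exists_sq_eq_one_add (b / a)
  obtain ⟨c, hc⟩ := IsAlgClosed.exists_pow_nat_eq a (n := 2) two_pos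
  refine ⟨PowerSeries.C c * s, ?_⟩
  rw [← sq, mul_pow, hs, ← map_pow, hc, mul_add, ← mul_assoc, ← map_mul, mul_div_cancel₀ _ ha,
    mul_one]

end LaurentSeries

/-- Over ℂ every polynomial is a square constant times linear factors. Thus once each U - r is a
square, v² = f(U) is solvable whether or not U lies over a branch point. -/
theorem isSquare_aeval_of_isSquare_sub {M : Type*} [CommRing M] [Algebra ℂ M] {U : M}
    (h : ∀ r, IsSquare (U - algebraMap ℂ M r)) (f : Polynomial ℂ) : IsSquare (Polynomial.aeval U f) := by
  have hs := (IsAlgClosed.splits f).eq_prod_roots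
  rw [hs, map_mul, Polynomial.aeval_C]
  obtain ⟨c, hc⟩ := IsAlgClosed.exists_pow_nat_eq f.leadingCoeff (n := 2) two_pos
  refine IsSquare.mul ⟨algebraMap ℂ M c, by rw [← map_mul, ← sq, hc]⟩ ?_
  induction f.roots using Multiset.induction_on with
  | empty => simp
  | cons a s ih =>
    rw [Multiset.map_cons, Multiset.prod_cons, map_mul]
    exact IsSquare.mul (by simpa using h a) ih

theorem aeval_ne_zero_of_forall_ne {M : Type*} [CommRing M] [IsDomain M] [Algebra ℂ M] {U : M}
    (h : ∀ r, U ≠ algebraMap ℂ M r) {f : Polynomial ℂ} (hf : f ≠ 0) : Polynomial.aeval U f ≠ 0 := by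
  have hs := (IsAlgClosed.splits f).eq_prod_roots
  rw [hs, map_mul, Polynomial.aeval_C]
  refine mul_ne_zero ?_ ?_
  · rw [Ne, FaithfulSMul.algebraMap_eq_zero_iff, Polynomial.leadingCoeff_eq_zero]; exact hf
  · induction f.roots using Multiset.induction_on with
    | empty => simp
    | cons a s ih =>
      rw [Multiset.map_cons, Multiset.prod_cons, map_mul]
      exact mul_ne_zero (by simpa [sub_eq_zero] using h a) ih

/-! ### The parametrizations u = r + t² and u = t⁻². -/

namespace LaurentSeries

/-- The series `r + t²`, a parametrization of a neighbourhood of `r` on a double cover. -/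
noncomputable def finiteParam (r : ℂ) : ℂ⸨X⸩ :=
  ((PowerSeries.C r + PowerSeries.X ^ 2 : ℂ⟦X⟧) : ℂ⸨X⸩)

/-- The series `t⁻²`, a parametrization of a neighbourhood of infinity on a double cover. -/
noncomputable def infiniteParam : ℂ⸨X⸩ := HahnSeries.single (-2) 1

theorem finiteParam_sub (r a : ℂ) : finiteParam r - algebraMap ℂ ℂ⸨X⸩ a =
    ((PowerSeries.C (r - a) + PowerSeries.C 1 * PowerSeries.X ^ 2 : ℂ⟦X⟧) : ℂ⸨X⸩) := by
  rw [finiteParam, algebraMap_eq_coe, ← PowerSeries.coe_sub, map_sub PowerSeries.C, map_one, one_mul]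
  rw [add_sub_right_comm]

theorem single_one_sq : (HahnSeries.single (1 : ℤ) (1 : ℂ)) ^ 2 =
    ((PowerSeries.X ^ 2 : ℂ⟦X⟧) : ℂ⸨X⸩) := by
  rw [PowerSeries.coe_pow, PowerSeries.coe_X]

theorem infiniteParam_sub (a : ℂ) : infiniteParam - algebraMap ℂ ℂ⸨X⸩ a =
    (HahnSeries.single (-1 : ℤ) (1 : ℂ)) ^ 2 *
    ((PowerSeries.C 1 + PowerSeries.C (-a) * PowerSeries.X ^ 2 : ℂ⟦X⟧) : ℂ⸨X⸩) := by
  have h : (HahnSeries.single (-1 : ℤ) (1 : ℂ)) ^ 2 * (HahnSeries.single (1 : ℤ) (1 : ℂ)) ^ 2 = 1 := by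
    rw [← mul_pow, HahnSeries.single_mul_single]; simp
  have h2 : (HahnSeries.single (-1 : ℤ) (1 : ℂ)) ^ 2 = infiniteParam := by
    rw [sq, HahnSeries.single_mul_single, infiniteParam]; norm_num
  rw [PowerSeries.coe_add, PowerSeries.coe_mul, ← single_one_sq, ← algebraMap_eq_coe,
    ← algebraMap_eq_coe, (algebraMap ℂ ℂ⸨X⸩).map_one, (algebraMap ℂ ℂ⸨X⸩).map_neg, ← h2]
  linear_combination (algebraMap ℂ ℂ⸨X⸩ a) * h

theorem isSquare_finiteParam_sub (r a : ℂ) : IsSquare (finiteParam r - algebraMap ℂ ℂ⸨X⸩ a) := by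
  rw [finiteParam_sub]
  by_cases h : r - a = 0
  · rw [h, map_zero, map_one, zero_add, one_mul, ← single_one_sq]
    exact IsSquare.sq _
  · exact (exists_sq_eq_coe _ 1 h).map _

theorem isSquare_infiniteParam_sub (a : ℂ) : IsSquare (infiniteParam - algebraMap ℂ ℂ⸨X⸩ a) := by
  rw [infiniteParam_sub]
  exact (IsSquare.sq _).mul ((exists_sq_eq_coe 1 (-a) one_ne_zero).map _)

theorem finiteParam_ne (r a : ℂ) : finiteParam r ≠ algebraMap ℂ ℂ⸨X⸩ a := by
  rw [← sub_ne_zero, finiteParam_sub]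
  intro h
  have := congrArg (fun f : ℂ⸨X⸩ => f.coeff (2 : ℕ)) h
  simp only [coeff_coe_powerSeries] at this
  simp [PowerSeries.coeff_X_pow] at this

theorem order_infiniteParam_sub (a : ℂ) :
    infiniteParam - algebraMap ℂ ℂ⸨X⸩ a ≠ 0 ∧ (infiniteParam - algebraMap ℂ ℂ⸨X⸩ a).order = -2 := by
  have h0 : infiniteParam - algebraMap ℂ ℂ⸨X⸩ a ≠ 0 := by
    intro h
    have := congrArg (fun f : ℂ⸨X⸩ => f.coeff (-2)) h
    rw [algebraMap_eq_coe] at this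
    simp [infiniteParam] at this
  refine ⟨h0, le_antisymm (HahnSeries.order_le_of_coeff_ne_zero ?_) ?_⟩
  · rw [algebraMap_eq_coe]
    simp [infiniteParam]
  · by_contra! h
    refine HahnSeries.coeff_order_eq_zero.not.mpr h0 ?_
    generalize (infiniteParam - algebraMap ℂ ℂ⸨X⸩ a).order = n at h
    rw [algebraMap_eq_coe, HahnSeries.coeff_sub, infiniteParam,
      HahnSeries.coeff_single_of_ne h.ne, PowerSeries.coeff_coe, if_pos (by omega), sub_zero]

theorem order_aeval_infiniteParam {f : Polynomial ℂ} (hf : f ≠ 0) :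
    (Polynomial.aeval infiniteParam f).order = -2 * (f.natDegree : ℤ) := by
  have hs := (IsAlgClosed.splits f).eq_prod_roots
  have key : ∀ s : Multiset ℂ, Polynomial.aeval infiniteParam (s.map fun a => Polynomial.X - Polynomial.C a).prod ≠ 0 ∧
      (Polynomial.aeval infiniteParam (s.map fun a => Polynomial.X - Polynomial.C a).prod).order = -2 * (Multiset.card s : ℤ) := by
    intro s
    induction s using Multiset.induction_on with
    | empty => simp
    | cons a s ih =>
      have ha := order_infiniteParam_sub a
      rw [Multiset.map_cons, Multiset.prod_cons, map_mul, map_sub, Polynomial.aeval_X, Polynomial.aeval_C]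
      refine ⟨mul_ne_zero ha.1 ih.1, ?_⟩
      rw [HahnSeries.order_mul ha.1 ih.1, ha.2, ih.2, Multiset.card_cons]
      push_cast
      ring
  have hl : (f.leadingCoeff) ≠ 0 := Polynomial.leadingCoeff_ne_zero.mpr hf
  have hl' : algebraMap ℂ ℂ⸨X⸩ f.leadingCoeff ≠ 0 := by
    rw [Ne, FaithfulSMul.algebraMap_eq_zero_iff]; exact hl
  have hC : (algebraMap ℂ ℂ⸨X⸩ f.leadingCoeff).order = 0 := HahnSeries.order_C
  conv_lhs => rw [hs, map_mul, Polynomial.aeval_C, HahnSeries.order_mul hl' (key _).1, hC, (key _).2, zero_add]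
  rw [(IsAlgClosed.splits f).natDegree_eq_card_roots]

theorem derivation_finiteParam (r : ℂ) : derivation ℂ (finiteParam r) =
    ((PowerSeries.C 2 * PowerSeries.X : ℂ⟦X⟧) : ℂ⸨X⸩) := by
  refine (derivative_coe _).trans ?_
  congr 1
  rw [map_add, PowerSeries.derivative_C, Derivation.leibniz_pow, PowerSeries.derivative_X]
  rw [map_ofNat PowerSeries.C 2]
  simp

theorem derivation_infiniteParam : derivation ℂ infiniteParam = HahnSeries.single (-3) (-2 : ℂ) := by
  refine (derivative_apply _).trans ?_
  rw [infiniteParam, hasseDeriv_single]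
  norm_num

end LaurentSeries

/-! ### Testing and producing regular differentials. -/

section Differentials

variable {K : Type*} [Field K] [Algebra ℂ K]

/-- An embedding in the field of Laurent series induces a map on differentials. -/
theorem exists_kaehler_hom (σ : K →ₐ[ℂ] ℂ⸨X⸩) : ∃ Φ : Ω[K⁄ℂ] →+ ℂ⸨X⸩,
    (∀ x ω, Φ (x • ω) = σ x * Φ ω) ∧ ∀ w, Φ (D ℂ K w) = LaurentSeries.derivation ℂ (σ w) := by
  let _ : Algebra K ℂ⸨X⸩ := σ.toRingHom.toAlgebra
  have _ : IsScalarTower ℂ K ℂ⸨X⸩ := IsScalarTower.of_algebraMap_eq fun r => (σ.commutes r).symm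
  let L := ((LaurentSeries.derivation ℂ).compAlgebraMap K).liftKaehlerDifferential
  refine ⟨AddMonoidHom.mk' L (map_add L), fun x ω => ?_, fun w => ?_⟩
  · rw [AddMonoidHom.mk'_apply, map_smul, Algebra.smul_def]
    rfl
  · exact Derivation.liftKaehlerDifferential_comp_D _ _

/-- The preimage of ℂ⟦t⟧ under σ is one of the valuation rings in the definition of regularity, and
differentials of that ring pull back to power series. -/
theorem mem_integers_of_mem_regularDifferentials {x w : K}
    (h : x • D ℂ K w ∈ QuadraticSystem.regularDifferentials ℂ K) (σ : K →ₐ[ℂ] ℂ⸨X⸩) :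
    σ x * LaurentSeries.derivation ℂ (σ w) ∈ LaurentSeries.integers := by
  obtain ⟨Φ, hs, hΦ⟩ := exists_kaehler_hom σ
  rw [← hΦ, ← hs]
  let O : Subalgebra ℂ K := LaurentSeries.integers.comap σ
  have hO : ∀ x : K, x ∈ O ∨ x⁻¹ ∈ O := by
    intro x
    have := LaurentSeries.mem_integers_or_inv (σ x)
    rwa [← map_inv₀] at this
  rw [QuadraticSystem.regularDifferentials, Submodule.mem_iInf] at h
  have h := h O
  rw [Submodule.mem_iInf] at h
  obtain ⟨η, hη⟩ := h hO
  rw [← hη]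
  have hspan : η ∈ Submodule.span O (Set.range (D ℂ O)) := by
    rw [KaehlerDifferential.span_range_derivation]; trivial
  clear hη
  induction hspan using Submodule.span_induction with
  | mem y hy =>
    obtain ⟨y, rfl⟩ := hy
    rw [KaehlerDifferential.map_D, hΦ]
    exact LaurentSeries.derivative_mem_integers y.2
  | zero => rw [map_zero, map_zero]; exact zero_mem _
  | add a b _ _ ha hb => rw [map_add, map_add]; exact add_mem ha hb
  | smul a b _ hb =>
    rw [map_smul]
    have key : Φ (a • KaehlerDifferential.map ℂ ℂ O K b) =
      σ (a : K) * Φ (KaehlerDifferential.map ℂ ℂ O K b) := hs (a : K) _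
    rw [key]
    exact mul_mem a.2 hb

theorem kaehler_map_aeval {p : Polynomial ℂ} (w : K) :
    D ℂ K (Polynomial.aeval w p) = Polynomial.aeval w (Polynomial.derivative p) • D ℂ K w :=
  Derivation.map_aeval _ _ _

/-- At a valuation ring containing `u`, the basic differentials of `v² = f(u)` are regular. -/
theorem mem_range_map_of_mem {f : Polynomial ℂ} (hf : f.Separable) {u v : K} (hv : v ≠ 0)
    (h : v ^ 2 = Polynomial.aeval u f) {O : Subalgebra ℂ K} (hO : ∀ x : K, x ∈ O ∨ x⁻¹ ∈ O)
    (hu : u ∈ O) : v⁻¹ • D ℂ K u ∈ LinearMap.range (KaehlerDifferential.map ℂ ℂ O K) ∧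
      (u * v⁻¹) • D ℂ K u ∈ LinearMap.range (KaehlerDifferential.map ℂ ℂ O K) := by
  have hfu : ∀ p : Polynomial ℂ, Polynomial.aeval u p ∈ O := fun p => by
    have := (Polynomial.aeval (⟨u, hu⟩ : O) p).2
    rwa [← Subalgebra.coe_val, ← Polynomial.aeval_algHom_apply] at this
  have hvO : v ∈ O := by
    rcases hO v with h1 | h1
    · exact h1
    · have : v = v ^ 2 * v⁻¹ := by field_simp
      rw [this, h]
      exact mul_mem (hfu f) h1
  obtain ⟨a, b, hab⟩ := hf
  have : CharZero K := charZero_of_injective_algebraMap (algebraMap ℂ K).injective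
  have hDv : D ℂ K v = (Polynomial.aeval u (Polynomial.derivative f) / (2 * v)) • D ℂ K u := by
    have h1 := congrArg (D ℂ K) h
    rw [kaehler_map_aeval, Derivation.leibniz_pow] at h1
    rw [div_eq_inv_mul, mul_smul, ← h1, ← Nat.cast_smul_eq_nsmul K, smul_smul, smul_smul]
    convert (one_smul K _).symm using 2
    push_cast
    field_simp
  -- From a f + b f' = 1, f(u) = v² and f'(u) du = 2v dv one gets du/v = a v du + 2b dv, with no
  -- division by v, so the branch points need no separate treatment.
  have key : v⁻¹ • D ℂ K u = (Polynomial.aeval u a * v) • D ℂ K u +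
      (2 * Polynomial.aeval u b) • D ℂ K v := by
    rw [hDv, smul_smul, ← add_smul]
    congr 1
    have h1 := congrArg (Polynomial.aeval u) hab
    rw [map_add, map_mul, map_mul, map_one, ← h] at h1
    field_simp
    linear_combination -h1
  have h2 : (2 : K) ∈ O := by
    have := O.algebraMap_mem 2
    rwa [map_ofNat] at this
  have hD : ∀ x y : K, x ∈ O → y ∈ O → ∃ η : Ω[O⁄ℂ],
      KaehlerDifferential.map ℂ ℂ O K η = x • D ℂ K y := by
    intro x y hx hy
    refine ⟨(⟨x, hx⟩ : O) • D ℂ O ⟨y, hy⟩, ?_⟩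
    rw [map_smul, KaehlerDifferential.map_D]
    rfl
  obtain ⟨η, hη⟩ := hD (Polynomial.aeval u a * v) u (mul_mem (hfu a) hvO) hu
  obtain ⟨θ, hθ⟩ := hD (2 * Polynomial.aeval u b) v (mul_mem h2 (hfu b)) hvO
  have h3 : KaehlerDifferential.map ℂ ℂ O K (η + θ) = v⁻¹ • D ℂ K u := by
    rw [map_add, hη, hθ, key]
  refine ⟨⟨_, h3⟩, ⟨(⟨u, hu⟩ : O) • (η + θ), ?_⟩⟩
  rw [map_smul, h3, mul_smul]
  rfl

end Differentials

/-! ### Function fields v² = f(u) and their regular differentials. -/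

open Polynomial in
/-- `K` is the function field of the curve `v² = f(u)`; its embeddings in the field of Laurent
series correspond to the nonconstant parametrizations of the curve. -/
structure IsHyperelliptic (f : ℂ[X]) (K : Type*) [Field K] [Algebra ℂ K] (u v : K) : Prop where
  sq_eq : v ^ 2 = Polynomial.aeval u f
  aeval_ne_zero : ∀ p : ℂ[X], p ≠ 0 → Polynomial.aeval u p ≠ 0
  exists_eq : ∀ x : K, ∃ a s b r : ℂ[X], IsCoprime a s ∧ IsCoprime b r ∧ s ≠ 0 ∧ r ≠ 0 ∧
    x = Polynomial.aeval u a / Polynomial.aeval u s +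
      Polynomial.aeval u b / Polynomial.aeval u r * v
  exists_algHom : ∀ U V : ℂ⸨X⸩, (∀ r, U ≠ algebraMap ℂ ℂ⸨X⸩ r) → V ^ 2 = Polynomial.aeval U f →
    ∃ σ : K →ₐ[ℂ] ℂ⸨X⸩, σ u = U ∧ σ v = V

namespace LaurentSeries

theorem aeval_finiteParam (r : ℂ) (p : Polynomial ℂ) :
    ∃ F : ℂ⟦X⟧, Polynomial.aeval (finiteParam r) p =
      ((PowerSeries.C (p.eval r) + PowerSeries.X ^ 2 * F : ℂ⟦X⟧) : ℂ⸨X⸩) := by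
  induction p using Polynomial.induction_on' with
  | add p q hp hq =>
    obtain ⟨F, hF⟩ := hp
    obtain ⟨G, hG⟩ := hq
    refine ⟨F + G, ?_⟩
    rw [map_add, hF, hG, ← PowerSeries.coe_add, Polynomial.eval_add, map_add PowerSeries.C]
    congr 1
    ring
  | monomial n c =>
    have h : PowerSeries.X ^ 2 ∣ (PowerSeries.C r + PowerSeries.X ^ 2 : ℂ⟦X⟧) ^ n -
        PowerSeries.C r ^ n := by
      refine Dvd.dvd.trans (Dvd.intro 1 ?_) (sub_dvd_pow_sub_pow _ _ n)
      ring
    obtain ⟨F, hF⟩ := h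
    refine ⟨PowerSeries.C c * F, ?_⟩
    rw [Polynomial.aeval_monomial, finiteParam, algebraMap_eq_coe, ← map_pow, ← PowerSeries.coe_mul,
      Polynomial.eval_monomial, map_mul PowerSeries.C, map_pow PowerSeries.C]
    congr 1
    linear_combination (PowerSeries.C c) * hF

theorem aeval_finiteParam_mem_integers (r : ℂ) (p : Polynomial ℂ) :
    Polynomial.aeval (finiteParam r) p ∈ integers := by
  obtain ⟨F, hF⟩ := aeval_finiteParam r p
  exact ⟨_, hF.symm⟩

/-- Polynomials in r + t² are power series in t², so a zero of s at r gives a/s a pole of order at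
least 2, while dU = 2t dt cancels only one factor t. Doubling the parameter therefore loses no
information. -/
theorem eval_ne_zero_of_mem_integers {r : ℂ} {a s : Polynomial ℂ} (h : IsCoprime a s) (hs : s ≠ 0)
    (hmem : Polynomial.aeval (finiteParam r) a / Polynomial.aeval (finiteParam r) s *
      derivation ℂ (finiteParam r) ∈ integers) : s.eval r ≠ 0 := by
  intro h0
  obtain ⟨R, hR⟩ := hmem
  obtain ⟨F, hF⟩ := aeval_finiteParam r a
  obtain ⟨G, hG⟩ := aeval_finiteParam r s
  have hs0 := aeval_ne_zero_of_forall_ne (finiteParam_ne r) hs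
  rw [div_mul_eq_mul_div, eq_div_iff hs0, hF, hG, derivation_finiteParam, ← map_mul, ← map_mul] at hR
  have hR := HahnSeries.ofPowerSeries_injective hR
  rw [h0, map_zero, zero_add] at hR
  have hX : (PowerSeries.X : ℂ⟦X⟧) ≠ 0 := PowerSeries.X_ne_zero
  have h1 : PowerSeries.C 2 * (PowerSeries.C (a.eval r) + PowerSeries.X ^ 2 * F) =
      PowerSeries.X * (R * G) := by
    apply mul_left_cancel₀ hX
    linear_combination -hR
  have h2 := congrArg PowerSeries.constantCoeff h1
  simp at h2
  obtain ⟨c, d, hcd⟩ := h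
  have h3 := congrArg (Polynomial.eval r) hcd
  simp [h0, h2] at h3

end LaurentSeries

namespace IsHyperelliptic

variable {f : Polynomial ℂ} {K : Type*} [Field K] [Algebra ℂ K] {u v : K}

theorem ne_zero (h : IsHyperelliptic f K u v) (hf : f ≠ 0) : v ≠ 0 := by
  rintro rfl
  exact h.aeval_ne_zero f hf (by rw [← h.sq_eq]; ring)

theorem exists_eq_smul (h : IsHyperelliptic f K u v) (hf : f ≠ 0) (ω : Ω[K⁄ℂ]) :
    ∃ x : K, ω = x • D ℂ K u := by
  have : CharZero K := charZero_of_injective_algebraMap (algebraMap ℂ K).injective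
  suffices ω ∈ Submodule.span K {D ℂ K u} by
    obtain ⟨x, hx⟩ := Submodule.mem_span_singleton.mp this
    exact ⟨x, hx.symm⟩
  have hp : ∀ p : Polynomial ℂ, D ℂ K (Polynomial.aeval u p) ∈ Submodule.span K {D ℂ K u} :=
    fun p => by
      rw [kaehler_map_aeval]
      exact Submodule.smul_mem _ _ (Submodule.mem_span_singleton_self _)
  have hdiv : ∀ a b : K, D ℂ K a ∈ Submodule.span K {D ℂ K u} →
      D ℂ K b ∈ Submodule.span K {D ℂ K u} → D ℂ K (a / b) ∈ Submodule.span K {D ℂ K u} := by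
    intro a b ha hb
    rw [Derivation.leibniz_div]
    exact Submodule.smul_mem _ _ (Submodule.sub_mem _ (Submodule.smul_mem _ _ ha)
      (Submodule.smul_mem _ _ hb))
  have hv : D ℂ K v ∈ Submodule.span K {D ℂ K u} := by
    have h1 := congrArg (D ℂ K) h.sq_eq
    rw [Derivation.leibniz_pow] at h1
    have h2 : D ℂ K v = (2 * v)⁻¹ • D ℂ K (Polynomial.aeval u f) := by
      rw [← h1, ← Nat.cast_smul_eq_nsmul K, smul_smul, smul_smul]
      convert (one_smul K _).symm using 2
      have := h.ne_zero hf
      push_cast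
      field_simp
    rw [h2]
    exact Submodule.smul_mem _ _ (hp f)
  have hω : ω ∈ Submodule.span K (Set.range (D ℂ K)) := by
    rw [KaehlerDifferential.span_range_derivation]; trivial
  refine Submodule.span_le.mpr ?_ hω
  rintro _ ⟨x, rfl⟩
  obtain ⟨a, s, b, r, -, -, -, -, rfl⟩ := h.exists_eq x
  rw [SetLike.mem_coe, map_add, Derivation.leibniz]
  exact Submodule.add_mem _ (hdiv _ _ (hp _) (hp _)) (Submodule.add_mem _
    (Submodule.smul_mem _ _ hv) (Submodule.smul_mem _ _ (hdiv _ _ (hp _) (hp _))))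

/-- Both square roots V and -V define embeddings; half the difference and half the sum of the two
pullbacks separate the parts of x that are odd and even under v ↦ -v. -/
theorem mem_integers_of_mem_regularDifferentials (h : IsHyperelliptic f K u v) (hf : f ≠ 0)
    {x : K} (hx : x • D ℂ K u ∈ QuadraticSystem.regularDifferentials ℂ K)
    {a s b r : Polynomial ℂ}
    (hxv : x * v = Polynomial.aeval u a / Polynomial.aeval u s +
      Polynomial.aeval u b / Polynomial.aeval u r * v)
    {U V : ℂ⸨X⸩} (hU : ∀ r, U ≠ algebraMap ℂ ℂ⸨X⸩ r) (hV : V ^ 2 = Polynomial.aeval U f) :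
    Polynomial.aeval U a / Polynomial.aeval U s / V * LaurentSeries.derivation ℂ U ∈
        LaurentSeries.integers ∧
      Polynomial.aeval U b / Polynomial.aeval U r * LaurentSeries.derivation ℂ U ∈
        LaurentSeries.integers := by
  have hV0 : V ≠ 0 := by
    rintro rfl
    exact aeval_ne_zero_of_forall_ne hU hf (by rw [← hV]; ring)
  have key : ∀ W : ℂ⸨X⸩, W ≠ 0 → W ^ 2 = Polynomial.aeval U f →
      (Polynomial.aeval U a / Polynomial.aeval U s / W +
        Polynomial.aeval U b / Polynomial.aeval U r) * LaurentSeries.derivation ℂ U ∈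
        LaurentSeries.integers := by
    intro W hW0 hW
    obtain ⟨σ, hσu, hσv⟩ := h.exists_algHom U W hU hW
    have h1 := _root_.mem_integers_of_mem_regularDifferentials hx σ
    have h2 : σ x * W = Polynomial.aeval U a / Polynomial.aeval U s +
        Polynomial.aeval U b / Polynomial.aeval U r * W := by
      have := congrArg σ hxv
      simpa only [map_mul, map_add, map_div₀, ← Polynomial.aeval_algHom_apply, hσu, hσv] using this
    have h3 : σ x = Polynomial.aeval U a / Polynomial.aeval U s / W +
        Polynomial.aeval U b / Polynomial.aeval U r := by
      rw [← mul_div_cancel_right₀ (σ x) hW0, h2, add_div, mul_div_cancel_right₀ _ hW0]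
    rwa [h3, hσu] at h1
  have h1 := key V hV0 hV
  have h2 := key (-V) (neg_ne_zero.mpr hV0) (by linear_combination hV)
  have hhalf : algebraMap ℂ ℂ⸨X⸩ (1 / 2) ∈ LaurentSeries.integers := Subalgebra.algebraMap_mem _ _
  have hhalf2 : algebraMap ℂ ℂ⸨X⸩ (1 / 2) * 2 = 1 := by
    rw [← map_ofNat (algebraMap ℂ ℂ⸨X⸩) 2, ← map_mul, one_div, inv_mul_cancel₀ two_ne_zero, map_one]
  have hneg (w : ℂ⸨X⸩) : w / -V = -(w / V) := div_neg w
  rw [hneg] at h2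
  constructor
  · convert mul_mem hhalf (sub_mem h1 h2) using 1
    linear_combination (-(Polynomial.aeval U a / Polynomial.aeval U s / V *
      LaurentSeries.derivation ℂ U)) * hhalf2
  · convert mul_mem hhalf (add_mem h1 h2) using 1
    linear_combination (-(Polynomial.aeval U b / Polynomial.aeval U r *
      LaurentSeries.derivation ℂ U)) * hhalf2

/-- Write x v = a/s + (b/r) v. Regularity at the finite points makes s and r constant; regularity at
infinity then forces b = 0 and deg a ≤ 1. -/
theorem exists_eq_of_mem_regularDifferentials (h : IsHyperelliptic f K u v)
    (hdeg : f.natDegree = 6) {x : K}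
    (hx : x • D ℂ K u ∈ QuadraticSystem.regularDifferentials ℂ K) :
    ∃ c₀ c₁ : ℂ, x = (algebraMap ℂ K c₀ + algebraMap ℂ K c₁ * u) * v⁻¹ := by
  have hf : f ≠ 0 := by rintro rfl; simp at hdeg
  have hv := h.ne_zero hf
  obtain ⟨a, s, b, r, has, hbr, hs, hr, hxv⟩ := h.exists_eq (x * v)
  have hfin : ∀ c : ℂ, s.eval c ≠ 0 ∧ r.eval c ≠ 0 := by
    intro c
    obtain ⟨V, hV⟩ := isSquare_aeval_of_isSquare_sub (LaurentSeries.isSquare_finiteParam_sub c) f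
    rw [← sq] at hV
    have hVint : V ∈ LaurentSeries.integers := by
      apply LaurentSeries.mem_integers_of_sq
      rw [← hV]
      exact LaurentSeries.aeval_finiteParam_mem_integers c f
    have hV0 : V ≠ 0 := by
      rintro rfl
      exact aeval_ne_zero_of_forall_ne (LaurentSeries.finiteParam_ne c) hf (by rw [hV]; ring)
    obtain ⟨h1, h2⟩ := h.mem_integers_of_mem_regularDifferentials hf hx hxv
      (LaurentSeries.finiteParam_ne c) hV.symm
    refine ⟨LaurentSeries.eval_ne_zero_of_mem_integers has hs ?_,
      LaurentSeries.eval_ne_zero_of_mem_integers hbr hr h2⟩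
    convert mul_mem hVint h1 using 1
    field_simp
  have hconst : ∀ p : Polynomial ℂ, (∀ c, p.eval c ≠ 0) → ∃ c : ℂ, c ≠ 0 ∧ p = Polynomial.C c := by
    intro p hp
    by_cases hd : p.degree = 0
    · refine ⟨p.coeff 0, ?_, Polynomial.eq_C_of_degree_eq_zero hd⟩
      intro h0
      rw [Polynomial.eq_C_of_degree_eq_zero hd, h0] at hd
      simp at hd
    · obtain ⟨c, hc⟩ := IsAlgClosed.exists_root p hd
      exact absurd hc (hp c)
  obtain ⟨s₀, hs₀, rfl⟩ := hconst s fun c => (hfin c).1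
  obtain ⟨r₀, hr₀, rfl⟩ := hconst r fun c => (hfin c).2
  obtain ⟨V, hV⟩ := isSquare_aeval_of_isSquare_sub LaurentSeries.isSquare_infiniteParam_sub f
  rw [← sq] at hV
  have hU : ∀ r, LaurentSeries.infiniteParam ≠ algebraMap ℂ ℂ⸨X⸩ r := fun r =>
    sub_ne_zero.mp (LaurentSeries.order_infiniteParam_sub r).1
  have hV0 : V ≠ 0 := by
    rintro rfl
    exact aeval_ne_zero_of_forall_ne hU hf (by rw [hV]; ring)
  have hVord : V.order = -6 := by
    have h1 := LaurentSeries.order_aeval_infiniteParam hf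
    rw [hV, hdeg, sq, HahnSeries.order_mul hV0 hV0] at h1
    push_cast at h1
    omega
  obtain ⟨h1, h2⟩ := h.mem_integers_of_mem_regularDifferentials hf hx hxv
    hU hV.symm
  have hd0 : LaurentSeries.derivation ℂ LaurentSeries.infiniteParam ≠ 0 ∧
      (LaurentSeries.derivation ℂ LaurentSeries.infiniteParam).order = -3 := by
    rw [LaurentSeries.derivation_infiniteParam]
    exact ⟨HahnSeries.single_ne_zero (by norm_num), HahnSeries.order_single (by norm_num)⟩
  have hC : ∀ c : ℂ, c ≠ 0 → algebraMap ℂ ℂ⸨X⸩ c ≠ 0 ∧ (algebraMap ℂ ℂ⸨X⸩ c).order = 0 :=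
    fun c hc => ⟨by rwa [Ne, FaithfulSMul.algebraMap_eq_zero_iff], HahnSeries.order_C⟩
  -- At infinity b dU has order -2 deg b - 3, which is negative.
  have hb : b = 0 := by
    by_contra hb
    have hb0 := aeval_ne_zero_of_forall_ne hU hb
    have h3 := LaurentSeries.order_nonneg_of_mem_integers
      (mul_mem (Subalgebra.algebraMap_mem _ r₀) h2)
    rw [Polynomial.aeval_C, ← mul_assoc, mul_div_cancel₀ _ (hC r₀ hr₀).1,
      HahnSeries.order_mul hb0 hd0.1, hd0.2, LaurentSeries.order_aeval_infiniteParam hb] at h3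
    omega
  -- The order of a dU / V at infinity is -2 deg a - 3 + 6, nonnegative only for deg a ≤ 1.
  have ha : a.natDegree ≤ 1 := by
    by_cases ha : a = 0
    · rw [ha]; simp
    have ha0 := aeval_ne_zero_of_forall_ne hU ha
    set R := Polynomial.aeval LaurentSeries.infiniteParam a /
      Polynomial.aeval LaurentSeries.infiniteParam (Polynomial.C s₀) / V *
      LaurentSeries.derivation ℂ LaurentSeries.infiniteParam with hR
    rw [Polynomial.aeval_C] at hR
    have hs1 := (hC s₀ hs₀).1
    have hR0 : R ≠ 0 := by
      rw [hR]
      exact mul_ne_zero (div_ne_zero (div_ne_zero ha0 hs1) hV0) hd0.1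
    have h3 := LaurentSeries.order_nonneg_of_mem_integers h1
    have h4 : Polynomial.aeval LaurentSeries.infiniteParam a *
        LaurentSeries.derivation ℂ LaurentSeries.infiniteParam =
        algebraMap ℂ ℂ⸨X⸩ s₀ * (R * V) := by
      rw [hR]
      field_simp
    have h5 := congrArg HahnSeries.order h4
    rw [HahnSeries.order_mul ha0 hd0.1, HahnSeries.order_mul hs1 (mul_ne_zero hR0 hV0),
      HahnSeries.order_mul hR0 hV0, hd0.2, LaurentSeries.order_aeval_infiniteParam ha,
      (hC s₀ hs₀).2, hVord] at h5
    omega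
  obtain ⟨c₁, c₀, rfl⟩ := Polynomial.exists_eq_X_add_C_of_natDegree_le_one ha
  refine ⟨c₀ / s₀, c₁ / s₀, ?_⟩
  have hs1 : algebraMap ℂ K s₀ ≠ 0 := by rwa [Ne, FaithfulSMul.algebraMap_eq_zero_iff]
  rw [eq_mul_inv_iff_mul_eq₀ hv, hxv, hb]
  simp only [map_add, map_mul, Polynomial.aeval_C, Polynomial.aeval_X, map_zero, map_div₀]
  field_simp
  ring

/-- When u⁻¹ is integral, pass to u' = 1/u and v' = v/u³, which satisfy v'² = f.reverse(u'). Up to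
sign, this change of chart exchanges du/v and u du/v. -/
theorem mem_regularDifferentials (h : IsHyperelliptic f K u v) (hf : f.Separable)
    (hf' : f.reverse.Separable) (hdeg : f.natDegree = 6) :
    v⁻¹ • D ℂ K u ∈ QuadraticSystem.regularDifferentials ℂ K ∧
      (u * v⁻¹) • D ℂ K u ∈ QuadraticSystem.regularDifferentials ℂ K := by
  have hv := h.ne_zero hf.ne_zero
  have hu : u ≠ 0 := by
    have := h.aeval_ne_zero Polynomial.X Polynomial.X_ne_zero
    rwa [Polynomial.aeval_X] at this
  have key : ∀ O : Subalgebra ℂ K, (∀ x : K, x ∈ O ∨ x⁻¹ ∈ O) →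
      v⁻¹ • D ℂ K u ∈ LinearMap.range (KaehlerDifferential.map ℂ ℂ O K) ∧
      (u * v⁻¹) • D ℂ K u ∈ LinearMap.range (KaehlerDifferential.map ℂ ℂ O K) := by
    intro O hO
    rcases hO u with hu1 | hu1
    · exact mem_range_map_of_mem hf hv h.sq_eq hO hu1
    · have hrev : (v * u⁻¹ ^ 3) ^ 2 = Polynomial.aeval u⁻¹ f.reverse := by
        let _ := invertibleOfNonzero hu
        have := Polynomial.eval₂_reverse_mul_pow (algebraMap ℂ K) u f
        rw [hdeg, invOf_eq_inv, ← Polynomial.aeval_def, ← Polynomial.aeval_def, ← h.sq_eq] at this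
        rw [mul_pow, ← this]
        field_simp
      have hv1 : v * u⁻¹ ^ 3 ≠ 0 := mul_ne_zero hv (pow_ne_zero _ (inv_ne_zero hu))
      obtain ⟨h1, h2⟩ := mem_range_map_of_mem hf' hv1 hrev hO hu1
      rw [Derivation.leibniz_inv, smul_smul] at h1 h2
      constructor
      · convert neg_mem h2 using 1
        rw [← neg_smul]
        congr 1
        field_simp
      · convert neg_mem h1 using 1
        rw [← neg_smul]
        congr 1
        field_simp
  constructor
  all_goals
    rw [QuadraticSystem.regularDifferentials, Submodule.mem_iInf]
    intro O
    rw [Submodule.mem_iInf]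
    intro hO
  · exact (key O hO).1
  · exact (key O hO).2

/-- A hyperelliptic curve `v² = f(u)` with `f` separable of degree six has genus two. -/
theorem finrank_regularDifferentials (h : IsHyperelliptic f K u v) (hf : f.Separable)
    (hf' : f.reverse.Separable) (hdeg : f.natDegree = 6) :
    Module.finrank ℂ (QuadraticSystem.regularDifferentials ℂ K) = 2 := by
  have hv := h.ne_zero hf.ne_zero
  obtain ⟨h1, h2⟩ := h.mem_regularDifferentials hf hf' hdeg
  -- The embedding u = t⁻² sends du to -2t⁻³, which is nonzero.
  have hDu : D ℂ K u ≠ 0 := by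
    intro h0
    obtain ⟨V, hV⟩ := isSquare_aeval_of_isSquare_sub LaurentSeries.isSquare_infiniteParam_sub f
    rw [← sq] at hV
    obtain ⟨σ, hσu, -⟩ := h.exists_algHom _ V (fun r =>
      sub_ne_zero.mp (LaurentSeries.order_infiniteParam_sub r).1) hV.symm
    obtain ⟨Φ, -, hΦ⟩ := exists_kaehler_hom σ
    have := hΦ u
    rw [h0, map_zero, hσu, LaurentSeries.derivation_infiniteParam] at this
    exact HahnSeries.single_ne_zero (by norm_num) this.symm
  have hli : LinearIndependent ℂ ![v⁻¹ • D ℂ K u, (u * v⁻¹) • D ℂ K u] := by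
    rw [LinearIndependent.pair_iff]
    intro c₀ c₁ hc
    rw [← algebraMap_smul K c₀, ← algebraMap_smul K c₁, smul_smul, smul_smul, ← add_smul,
      smul_eq_zero_iff_left hDu] at hc
    have hc' : Polynomial.aeval u (Polynomial.C c₀ + Polynomial.C c₁ * Polynomial.X) = 0 := by
      rw [map_add, map_mul, Polynomial.aeval_C, Polynomial.aeval_C, Polynomial.aeval_X]
      field_simp at hc
      linear_combination hc
    have h0 : Polynomial.C c₀ + Polynomial.C c₁ * Polynomial.X = 0 := by
      by_contra h0
      exact h.aeval_ne_zero _ h0 hc'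
    constructor
    · simpa using congrArg (fun p => Polynomial.coeff p 0) h0
    · simpa using congrArg (fun p => Polynomial.coeff p 1) h0
  have hspan : QuadraticSystem.regularDifferentials ℂ K =
      Submodule.span ℂ (Set.range ![v⁻¹ • D ℂ K u, (u * v⁻¹) • D ℂ K u]) := by
    rw [Matrix.range_cons, Matrix.range_cons, Matrix.range_empty, Set.union_empty,
      Set.singleton_union]
    refine le_antisymm (fun ω hω => ?_) (Submodule.span_le.mpr ?_)
    · obtain ⟨x, rfl⟩ := h.exists_eq_smul hf.ne_zero ω
      obtain ⟨c₀, c₁, rfl⟩ := h.exists_eq_of_mem_regularDifferentials hdeg hω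
      rw [Submodule.mem_span_pair]
      refine ⟨c₀, c₁, ?_⟩
      rw [← algebraMap_smul K c₀, ← algebraMap_smul K c₁, smul_smul, smul_smul, ← add_smul]
      congr 1
      ring
    · rintro ω (rfl | rfl)
      · exact h1
      · exact h2
  rw [hspan, finrank_span_eq_card hli, Fintype.card_fin]

end IsHyperelliptic

/-! ### Construction of the function field of v² = f(u). -/

/-- The polynomial `v² - f` over the field of rational functions. -/
noncomputable def hyperellipticPolynomial (f : Polynomial ℂ) : Polynomial (RatFunc ℂ) :=
  Polynomial.X ^ 2 - Polynomial.C (algebraMap (Polynomial ℂ) (RatFunc ℂ) f)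

/-- A square root of f in ℂ(u) is integral over ℂ[u], hence a polynomial; since f is squarefree it
is a unit, against the degree. -/
theorem irreducible_hyperellipticPolynomial {f : Polynomial ℂ} (hf : f.Separable)
    (hdeg : f.natDegree ≠ 0) : Irreducible (hyperellipticPolynomial f) := by
  refine X_pow_sub_C_irreducible_of_prime Nat.prime_two fun b hb => hdeg ?_
  obtain ⟨g, rfl⟩ := IsIntegrallyClosed.exists_algebraMap_eq_of_isIntegral_pow (R := Polynomial ℂ)
    two_pos (x := b) (by rw [hb]; exact isIntegral_algebraMap)
  rw [← map_pow] at hb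
  have h := RatFunc.algebraMap_injective ℂ hb
  have hg : IsUnit g := hf.squarefree g ⟨1, by rw [← h]; ring⟩
  rw [← h, Polynomial.natDegree_pow, Polynomial.natDegree_eq_zero_of_isUnit hg]

/-- The hyperelliptic function field of the curve `v² = f(u)`. -/
noncomputable abbrev HyperellipticField (f : Polynomial ℂ) : Type :=
  AdjoinRoot (hyperellipticPolynomial f)

namespace HyperellipticField

/-- The coordinate `u` of the curve `v² = f(u)`. -/
noncomputable def u (f : Polynomial ℂ) : HyperellipticField f := AdjoinRoot.of _ RatFunc.X

/-- The coordinate `v` of the curve `v² = f(u)`. -/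
noncomputable def v (f : Polynomial ℂ) : HyperellipticField f := AdjoinRoot.root _

theorem aeval_u (f p : Polynomial ℂ) : Polynomial.aeval (u f) p =
    AdjoinRoot.of (hyperellipticPolynomial f) (algebraMap (Polynomial ℂ) (RatFunc ℂ) p) := by
  have h : Polynomial.aeval (u f) = ((AdjoinRoot.ofAlgHom ℂ (hyperellipticPolynomial f)).comp
      (IsScalarTower.toAlgHom ℂ (Polynomial ℂ) (RatFunc ℂ))) := by
    ext
    simp [u]
  rw [h]
  rfl

theorem isHyperelliptic {f : Polynomial ℂ} [Fact (Irreducible (hyperellipticPolynomial f))] :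
    IsHyperelliptic f (HyperellipticField f) (u f) (v f) where
  sq_eq := by
    have h := AdjoinRoot.eval₂_root (hyperellipticPolynomial f)
    rw [hyperellipticPolynomial, Polynomial.eval₂_sub, Polynomial.eval₂_pow, Polynomial.eval₂_X,
      Polynomial.eval₂_C, sub_eq_zero] at h
    rw [aeval_u]
    exact h
  aeval_ne_zero p hp := by
    rw [aeval_u]
    refine (map_ne_zero_iff _ (AdjoinRoot.of (hyperellipticPolynomial f)).injective).mpr ?_
    exact (map_ne_zero_iff _ (RatFunc.algebraMap_injective ℂ)).mpr hp
  exists_eq x := by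
    obtain ⟨q, rfl⟩ := AdjoinRoot.mk_surjective x
    have hmonic : (hyperellipticPolynomial f).Monic := Polynomial.monic_X_pow_sub_C _ two_ne_zero
    have hdeg : (hyperellipticPolynomial f).degree = 2 := Polynomial.degree_X_pow_sub_C two_pos _
    have hq : AdjoinRoot.mk (hyperellipticPolynomial f) q =
        AdjoinRoot.mk (hyperellipticPolynomial f) (q %ₘ hyperellipticPolynomial f) := by
      conv_lhs => rw [← Polynomial.modByMonic_add_div q (hyperellipticPolynomial f)]
      rw [map_add, map_mul, AdjoinRoot.mk_self, zero_mul, add_zero]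
    have hlt : (q %ₘ hyperellipticPolynomial f).natDegree ≤ 1 := by
      have := Polynomial.degree_modByMonic_lt q hmonic
      rw [hdeg] at this
      rw [Polynomial.natDegree_le_iff_degree_le]
      exact Order.le_of_lt_succ this
    obtain ⟨β, α, hαβ⟩ := Polynomial.exists_eq_X_add_C_of_natDegree_le_one hlt
    refine ⟨α.num, α.denom, β.num, β.denom, RatFunc.isCoprime_num_denom α,
      RatFunc.isCoprime_num_denom β, RatFunc.denom_ne_zero α, RatFunc.denom_ne_zero β, ?_⟩
    rw [hq, hαβ, aeval_u, aeval_u, aeval_u, aeval_u,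
      ← map_div₀ (AdjoinRoot.of (hyperellipticPolynomial f)),
      ← map_div₀ (AdjoinRoot.of (hyperellipticPolynomial f)), RatFunc.num_div_denom,
      RatFunc.num_div_denom, map_add, map_mul, AdjoinRoot.mk_C, AdjoinRoot.mk_C, AdjoinRoot.mk_X,
      add_comm]
    rfl
  exists_algHom U V hU hV := by
    let φ : RatFunc ℂ →ₐ[ℂ] ℂ⸨X⸩ := RatFunc.liftAlgHom (Polynomial.aeval U) (by
      intro p hp
      rw [Submonoid.mem_comap, mem_nonZeroDivisors_iff_ne_zero]
      exact aeval_ne_zero_of_forall_ne hU (nonZeroDivisors.ne_zero hp))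
    have hφ : ∀ p : Polynomial ℂ, φ (algebraMap (Polynomial ℂ) (RatFunc ℂ) p) =
        Polynomial.aeval U p := by
      intro p
      have := RatFunc.liftAlgHom_apply_div (L := ℂ⸨X⸩) (S := ℂ) (φ := Polynomial.aeval U)
        (hφ := by
          intro p hp
          rw [Submonoid.mem_comap, mem_nonZeroDivisors_iff_ne_zero]
          exact aeval_ne_zero_of_forall_ne hU (nonZeroDivisors.ne_zero hp)) p 1
      simpa using this
    refine ⟨AdjoinRoot.liftAlgHom _ φ V ?_, ?_, ?_⟩
    · rw [hyperellipticPolynomial, Polynomial.eval₂_sub, Polynomial.eval₂_pow, Polynomial.eval₂_X,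
        Polynomial.eval₂_C, sub_eq_zero, hV]
      exact (hφ f).symm
    · rw [u, AdjoinRoot.liftAlgHom_of, ← RatFunc.algebraMap_X, hφ, Polynomial.aeval_X]
    · rw [v, AdjoinRoot.liftAlgHom_root]

end HyperellipticField

theorem map_aeval_apply {K L : Type*} [Field K] [Algebra ℂ K] [Field L] [Algebra ℂ L]
    (e : L ≃ₐ[ℂ] K) (u : L) (p : Polynomial ℂ) :
    e (Polynomial.aeval u p) = Polynomial.aeval (e u) p :=
  (Polynomial.aeval_algHom_apply e.toAlgHom u p).symm

theorem IsHyperelliptic.of_algEquiv {f : Polynomial ℂ} {K L : Type*} [Field K] [Algebra ℂ K]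
    [Field L] [Algebra ℂ L] {u v : L} (h : IsHyperelliptic f L u v) (e : L ≃ₐ[ℂ] K) :
    IsHyperelliptic f K (e u) (e v) where
  sq_eq := by
    rw [← map_pow, h.sq_eq, map_aeval_apply]
  aeval_ne_zero p hp := by
    rw [← map_aeval_apply]
    exact (map_ne_zero e).mpr (h.aeval_ne_zero p hp)
  exists_eq x := by
    obtain ⟨a, s, b, r, h1, h2, h3, h4, h5⟩ := h.exists_eq (e.symm x)
    refine ⟨a, s, b, r, h1, h2, h3, h4, ?_⟩
    rw [← e.apply_symm_apply x, h5]
    simp only [map_add, map_mul, map_div₀, map_aeval_apply]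
  exists_algHom U V hU hV := by
    obtain ⟨σ, h1, h2⟩ := h.exists_algHom U V hU hV
    exact ⟨σ.comp e.symm.toAlgHom, by simp [h1], by simp [h2]⟩

/-! ### The branch sextic and its separability. -/

namespace QuadraticSystem

/-- The branch polynomial of the genus two curves `v² = Δ(u)`. -/
noncomputable def branch (c : ℂ) : Polynomial ℂ :=
  Polynomial.C (-2) * Polynomial.X ^ 6 + Polynomial.C (9 * c - 3) * Polynomial.X ^ 5 +
    Polynomial.C (30 * c) * Polynomial.X ^ 4 + Polynomial.C (40 * c) * Polynomial.X ^ 3 +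
    Polynomial.C (30 * c) * Polynomial.X ^ 2 + Polynomial.C (9 * c - 3 * c ^ 2) * Polynomial.X +
    Polynomial.C (-2 * c ^ 2)

theorem natDegree_branch (c : ℂ) : (branch c).natDegree = 6 := by
  unfold branch
  compute_degree!

theorem aeval_branch {A : Type*} [CommRing A] [Algebra ℂ A] (c : ℂ) (u : A) :
    Polynomial.aeval u (branch c) = -2 * u ^ 6 + (9 * algebraMap ℂ A c - 3) * u ^ 5 +
      30 * algebraMap ℂ A c * u ^ 4 + 40 * algebraMap ℂ A c * u ^ 3 +
      30 * algebraMap ℂ A c * u ^ 2 + (9 * algebraMap ℂ A c - 3 * algebraMap ℂ A c ^ 2) * u -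
      2 * algebraMap ℂ A c ^ 2 := by
  simp only [branch, map_add, map_mul, map_pow, map_sub, map_neg, map_ofNat, Polynomial.aeval_C,
    Polynomial.aeval_X]
  ring

theorem eval_derivative_branch (c u : ℂ) :
    (Polynomial.derivative (branch c)).eval u = -12 * u ^ 5 + 5 * (9 * c - 3) * u ^ 4 +
      120 * c * u ^ 3 + 120 * c * u ^ 2 + 60 * c * u + (9 * c - 3 * c ^ 2) := by
  simp only [branch, Polynomial.derivative_add, Polynomial.derivative_C_mul,
    Polynomial.derivative_X_pow, Polynomial.derivative_C, Polynomial.derivative_X,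
    Polynomial.eval_add, Polynomial.eval_mul, Polynomial.eval_pow, Polynomial.eval_C,
    Polynomial.eval_X, Polynomial.eval_one, Polynomial.eval_zero]
  push_cast
  ring

theorem separable_branch {c : ℂ} (h0 : c ≠ 0) (h1 : c ≠ -1) : (branch c).Separable := by
  rw [Polynomial.Separable, Polynomial.isCoprime_iff_aeval_ne_zero_of_isAlgClosed ℂ ℂ]
  intro u
  by_contra! h
  obtain ⟨hΔ, hΔ'⟩ := h
  rw [aeval_branch, Algebra.algebraMap_self_apply] at hΔ
  rw [Polynomial.coe_aeval_eq_eval, eval_derivative_branch] at hΔ'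
  obtain ⟨P, rfl⟩ : ∃ P, u = P - 1 := ⟨u + 1, by ring⟩
  obtain ⟨d, rfl⟩ : ∃ d, c = d - 1 := ⟨c + 1, by ring⟩
  have hd : d ≠ 0 := fun h => h1 (by rw [h]; ring)
  -- In P = u + 1 and d = c + 1, the combination PΔ' - 6Δ is divisible by 3d, and the quotient is
  -- linear in d.
  have e1 : d * (5 * P - 2) = P ^ 3 * (3 * P ^ 2 - 10 * P + 10) := by
    have : 3 * d * (d * (5 * P - 2)) = 3 * d * (P ^ 3 * (3 * P ^ 2 - 10 * P + 10)) := by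
      linear_combination P * hΔ' - 6 * hΔ
    exact mul_left_cancel₀ (mul_ne_zero three_ne_zero hd) this
  have e2 : -4 * P ^ 5 + d * (15 * P ^ 4 - 20 * P ^ 3 + 10 * P ^ 2) - d ^ 2 = 0 := by
    linear_combination (1 / 3) * hΔ'
  have hP : P ≠ 0 := by
    rintro rfl
    apply hd
    linear_combination (-1 / 2) * e1
  -- Elimination of d: multiply `e2` by (5P - 2)² and replace d(5P - 2) by means of `e1`. The
  -- surviving roots P = 0 and P = 1 correspond to c = -1 and c = 0.
  have e3 : P ^ 5 * (216 * (P - 1) ^ 5) = 0 := by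
    linear_combination (5 * P - 2) ^ 2 * e2 - (5 * P - 2) * (15 * P ^ 4 - 20 * P ^ 3 + 10 * P ^ 2) * e1
      + (d * (5 * P - 2) + P ^ 3 * (3 * P ^ 2 - 10 * P + 10)) * e1
  have hP1 : P - 1 = 0 := by
    simpa [hP] using e3
  have : P = 1 := by linear_combination hP1
  subst this
  exact h0 (by linear_combination (1 / 3) * e1)

/-- The family of sextics is stable under (u, c) ↦ (1/u, 1/c), so separability of the reverse
polynomial costs no new elimination. -/
theorem reverse_branch {c : ℂ} (h0 : c ≠ 0) :
    (branch c).reverse = Polynomial.C (c ^ 2) * branch c⁻¹ := by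
  ext n
  rw [Polynomial.coeff_reverse, natDegree_branch]
  by_cases hn : n ≤ 6
  · rw [Polynomial.revAt_le hn]
    interval_cases n <;>
      simp only [branch, Polynomial.coeff_add, Polynomial.coeff_C_mul, Polynomial.coeff_X_pow,
        Polynomial.coeff_X, Polynomial.coeff_C] <;>
      norm_num <;> field_simp
  · rw [Polynomial.revAt_eq_self_of_lt (by omega), Polynomial.coeff_eq_zero_of_natDegree_lt,
      Polynomial.coeff_eq_zero_of_natDegree_lt]
    · exact (Polynomial.natDegree_C_mul_le _ _).trans_lt (by rw [natDegree_branch]; omega)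
    · rw [natDegree_branch]; omega

theorem separable_reverse_branch {c : ℂ} (h0 : c ≠ 0) (h1 : c ≠ -1) :
    (branch c).reverse.Separable := by
  rw [reverse_branch h0]
  have h2 : c⁻¹ ≠ -1 := fun h => h1 (by rw [← inv_inv c, h]; norm_num)
  exact (separable_branch (inv_ne_zero h0) h2).unit_mul
    (Polynomial.isUnit_C.mpr (pow_ne_zero 2 h0).isUnit)

/-! ### The pencil of A² and B³. -/

section Pencil

variable {R : Type*} [Field R]

/-- The quadratic-in-`y` invariant form: its cube spans, with the square of `formA`, the pencil
of the invariant curves. -/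
def formB (r z y : R) : R :=
  y ^ 2 - 8 * r * z * y + 64 * r ^ 2 * y * z ^ 3 + 256 * r ^ 4 * z ^ 6 - 256 * r ^ 3 * z ^ 4 +
    52 * r ^ 2 * z ^ 2 + 3 * r

/-- The cubic-in-`y` invariant form: its square spans, with the cube of `formB`, the pencil of the
invariant curves. -/
def formA (r z y : R) : R :=
  y ^ 3 - (12 * r * z + 120 * r ^ 2 * z ^ 3) * y ^ 2 +
    (9 / 2 * r - 60 * r ^ 2 * z ^ 2 + 960 * r ^ 3 * z ^ 4 - 1536 * r ^ 4 * z ^ 6) * y -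
    4096 * r ^ 6 * z ^ 9 + 6144 * r ^ 5 * z ^ 7 - 2784 * r ^ 4 * z ^ 5 + 296 * r ^ 3 * z ^ 3 -
    117 / 2 * r ^ 2 * z

/-- With z, y, r of weights -1, 1, 2 the form is homogeneous, which reduces everything to r = 1,
that is q = 13. -/
theorem formB_scale {l : R} (hl : l ≠ 0) (z y : R) :
    formB (l ^ 2) (z / l) (l * y) = l ^ 2 * formB 1 z y := by
  unfold formB
  field_simp

theorem formA_scale {l : R} (hl : l ≠ 0) (z y : R) :
    formA (l ^ 2) (z / l) (l * y) = l ^ 3 * formA 1 z y := by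
  unfold formA
  field_simp

/-- This places g in the pencil; the factor 432 (q/13)² is harmless as soon as q ≠ 0. -/
theorem eval_curve (p q : ℂ) (x : Fin 2 → ℂ) : 432 * (q / 13) ^ 2 * eval x (curve p q) =
    (p + 240 * (q / 13) ^ 2) * formB (q / 13) (x 0) (x 1) ^ 3 -
      (p - 192 * (q / 13) ^ 2) * formA (q / 13) (x 0) (x 1) ^ 2 := by
  simp only [curve, formA, formB, map_add, map_sub, map_mul, map_neg, map_pow, eval_C, eval_X]
  ring

theorem aeval_curve {M : Type*} [Field M] [Algebra ℂ M] (p r : ℂ) (x : Fin 2 → M) :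
    432 * algebraMap ℂ M r ^ 2 * aeval x (curve p (13 * r)) =
      (algebraMap ℂ M p + 240 * algebraMap ℂ M r ^ 2) *
          formB (algebraMap ℂ M r) (x 0) (x 1) ^ 3 -
        (algebraMap ℂ M p - 192 * algebraMap ℂ M r ^ 2) *
          formA (algebraMap ℂ M r) (x 0) (x 1) ^ 2 := by
  let B : MvPolynomial (Fin 2) ℂ :=
    y ^ 2 - 8 * C r * z * y + 64 * C r ^ 2 * y * z ^ 3 + 256 * C r ^ 4 * z ^ 6 -
      256 * C r ^ 3 * z ^ 4 + 52 * C r ^ 2 * z ^ 2 + 3 * C r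
  let A : MvPolynomial (Fin 2) ℂ :=
    y ^ 3 - (12 * C r * z + 120 * C r ^ 2 * z ^ 3) * y ^ 2 +
      (C (9 / 2) * C r - 60 * C r ^ 2 * z ^ 2 + 960 * C r ^ 3 * z ^ 4 - 1536 * C r ^ 4 * z ^ 6) * y -
      4096 * C r ^ 6 * z ^ 9 + 6144 * C r ^ 5 * z ^ 7 - 2784 * C r ^ 4 * z ^ 5 +
      296 * C r ^ 3 * z ^ 3 - C (117 / 2) * C r ^ 2 * z
  have h : 432 * C r ^ 2 * curve p (13 * r) =
      (C p + 240 * C r ^ 2) * B ^ 3 - (C p - 192 * C r ^ 2) * A ^ 2 := by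
    apply MvPolynomial.funext
    intro x
    have h1 := eval_curve p (13 * r) x
    rw [mul_div_cancel_left₀ r (by norm_num : (13 : ℂ) ≠ 0)] at h1
    simp only [A, B, map_add, map_sub, map_mul, map_pow, map_ofNat, eval_C, eval_X]
    exact h1
  have h2 := congrArg (aeval x) h
  simpa only [A, B, formA, formB, map_add, map_sub, map_mul, map_pow, map_ofNat, map_div₀,
    algHom_C, aeval_X] using h2

end Pencil

/-! ### The hyperelliptic parametrization. -/

section Parametrization

variable {R M : Type*} [CommRing R] [Field M]

/-- The constant term in `x` of the quadratic equation defining the parametrization. -/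
def quad0 (c u : R) : R := 3 * (u ^ 3 - 3 * c * u ^ 2 - 3 * c * u - c)

/-- The coefficient of `-2x` in the quadratic equation defining the parametrization. -/
def quad1 (c u : R) : R := u ^ 3 + 3 * u ^ 2 - 3 * c * u - c

/-- The leading coefficient of the quadratic equation defining the parametrization. -/
def quad2 (c u : R) : R := u ^ 3 + 3 * u ^ 2 + 3 * u - c

/-- A factor of the invariant forms along the curve. -/
def quartic (c u : R) : R := u ^ 4 + 2 * u ^ 3 + 2 * c * u + c

/-- A factor of the invariant forms along the curve. -/
def quintic (c u : R) : R := u ^ 5 + 3 * u ^ 4 + 2 * u ^ 3 + 2 * c * u ^ 2 + 3 * c * u + c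

/-- The discriminant of the quadratic equation defining the parametrization. -/
def discr (c u : R) : R := quad1 c u ^ 2 - quad0 c u * quad2 c u

/-- The numerator of the coordinate `y`. -/
def numer (c u : R) : R :=
  (3 * u ^ 2 * quad2 c u + quad0 c u) * (9 * (1 + c) * quartic c u) -
    4 * quad1 c u ^ 3 - 4 * quad1 c u * quad0 c u * quad2 c u

/-- The coordinate `z` of the parametrization, for `q = 13`. -/
def paramZ (c u v : M) : M := quad1 c u / (2 * v)

/-- The coordinate `y` of the parametrization, for `q = 13`. -/
def paramY (c u v : M) : M := numer c u / (2 * v ^ 3)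

variable [CharZero M] {c u v : M}

/-- B becomes a square and, in `formA_param`, A becomes a constant times a cube, with the same
product of quartic and quintic. This is what makes A²/B³ constant along the curve. -/
theorem formB_param (hv : v ≠ 0) (h : v ^ 2 = discr c u) :
    4 * v ^ 6 * formB 1 (paramZ c u v) (paramY c u v) =
      (27 * (1 + c) * quartic c u * quintic c u) ^ 2 := by
  -- After denominators are cleared v enters only through v², which the discriminant replaces; a
  -- polynomial identity in c and u remains.
  have h1 : 4 * v ^ 6 * formB 1 (paramZ c u v) (paramY c u v) =
      numer c u ^ 2 + (16 * quad1 c u ^ 2 - 8 * v ^ 2) * quad1 c u * numer c u +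
      16 * quad1 c u ^ 6 - 64 * quad1 c u ^ 4 * v ^ 2 + 52 * quad1 c u ^ 2 * (v ^ 2) ^ 2 +
      12 * (v ^ 2) ^ 3 := by
    simp only [formB, paramZ, paramY]
    field_simp
    ring
  rw [h1, h]
  simp only [numer, discr, quad0, quad1, quad2, quartic, quintic]
  ring

theorem formA_param (hv : v ≠ 0) (h : v ^ 2 = discr c u) :
    8 * v ^ 9 * formA 1 (paramZ c u v) (paramY c u v) =
      (c - 1) * (1 + c) ^ 2 * (27 * quartic c u * quintic c u) ^ 3 := by
  have h1 : 8 * v ^ 9 * formA 1 (paramZ c u v) (paramY c u v) =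
      numer c u ^ 3 - (12 * v ^ 2 + 30 * quad1 c u ^ 2) * quad1 c u * numer c u ^ 2 +
      (18 * (v ^ 2) ^ 3 - 60 * quad1 c u ^ 2 * (v ^ 2) ^ 2 + 240 * quad1 c u ^ 4 * v ^ 2
        - 96 * quad1 c u ^ 6) * numer c u -
      64 * quad1 c u ^ 9 + 384 * quad1 c u ^ 7 * v ^ 2 - 696 * quad1 c u ^ 5 * (v ^ 2) ^ 2 +
      296 * quad1 c u ^ 3 * (v ^ 2) ^ 3 - 234 * quad1 c u * (v ^ 2) ^ 4 := by
    simp only [formA, paramZ, paramY]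
    field_simp
    ring
  rw [h1, h]
  simp only [numer, discr, quad0, quad1, quad2, quartic, quintic]
  ring

end Parametrization

/-! ### Recovering u and v from z and y. -/

section Generation

theorem map_formB {R S : Type*} [Field R] [Field S] (f : R →+* S) (r z y : R) :
    f (formB r z y) = formB (f r) (f z) (f y) := by
  simp only [formB, map_add, map_sub, map_mul, map_pow, map_ofNat]

theorem map_formA {R S : Type*} [Field R] [Field S] (f : R →+* S) (r z y : R) :
    f (formA r z y) = formA (f r) (f z) (f y) := by
  simp only [formA, map_add, map_sub, map_mul, map_pow, map_ofNat, map_div₀]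

variable {M : Type*} [Field M] [CharZero M] {c u v : M}

/-- The parametrization is inverted explicitly: two auxiliary functions e and τ are rational in z
and y, u is a quotient of linear combinations of z, e, τ, and v is then read off from z. -/
theorem mem_of_param_mem (F : Subfield M) (hv : v ≠ 0) (h : v ^ 2 = discr c u) (hu : u ≠ 0)
    (hc : c ∈ F) (h1 : 1 + c ≠ 0) (h2 : 1 - c ≠ 0) (hquad : quad1 c u ≠ 0)
    (hquartic : quartic c u ≠ 0) (hquintic : quintic c u ≠ 0) (hz : paramZ c u v ∈ F)
    (hy : paramY c u v ∈ F) : u ∈ F ∧ v ∈ F := by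
  have hB := formB_param hv h
  have hA := formA_param hv h
  have hBF : formB 1 (paramZ c u v) (paramY c u v) ∈ F := by
    have h3 := map_formB F.subtype 1 ⟨_, hz⟩ ⟨_, hy⟩
    rw [map_one] at h3
    exact h3 ▸ Subtype.property _
  have hAF : formA 1 (paramZ c u v) (paramY c u v) ∈ F := by
    have h3 := map_formA F.subtype 1 ⟨_, hz⟩ ⟨_, hy⟩
    rw [map_one] at h3
    exact h3 ▸ Subtype.property _
  set z := paramZ c u v with hzdef
  set y := paramY c u v with hydef
  have hB0 : formB 1 z y ≠ 0 := by
    intro h0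
    rw [h0, mul_zero] at hB
    exact pow_ne_zero 2 (mul_ne_zero (mul_ne_zero (mul_ne_zero (by norm_num) h1) hquartic)
      hquintic) hB.symm
  have hw : (8 * z ^ 2 + 1) * v ^ 2 = 9 * (1 + c) * u * quartic c u := by
    have : (8 * z ^ 2 + 1) * v ^ 2 = 2 * quad1 c u ^ 2 + v ^ 2 := by
      rw [hzdef, paramZ]; field_simp; ring
    rw [this, h]
    simp only [discr, quad0, quad1, quad2, quartic]
    ring
  have hw0 : 8 * z ^ 2 + 1 ≠ 0 := by
    intro h0
    rw [h0, zero_mul] at hw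
    exact mul_ne_zero (mul_ne_zero (mul_ne_zero (by norm_num) h1) hu) hquartic hw.symm
  have hwF : 8 * z ^ 2 + 1 ∈ F := by
    exact add_mem (mul_mem (ofNat_mem F 8) (pow_mem hz 2)) (one_mem F)
  -- Chosen so that y = (8z² + 1)e - 32z³ + 4z, using the factorization of (8z² + 1)v² in `hw`.
  obtain ⟨e, he⟩ : ∃ e, e = (3 * u ^ 2 * quad2 c u + quad0 c u) / (2 * u * v) := ⟨_, rfl⟩
  -- Chosen to be a constant multiple of A / (B(8z² + 1)): in this quotient the quartic factors
  -- cancel and one quintic remains. Division by 1 - c is where c ≠ 1 enters.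
  obtain ⟨τ, hτ⟩ : ∃ τ, τ = -3 * quintic c u / (2 * u * v) := ⟨_, rfl⟩
  have heF : e ∈ F := by
    have : e = (y + 32 * z ^ 3 - 4 * z) / (8 * z ^ 2 + 1) := by
      rw [eq_div_iff hw0]
      have h3 : v ^ 2 * (e * (8 * z ^ 2 + 1)) = v ^ 2 * (y + 32 * z ^ 3 - 4 * z) := by
        have e1 : v ^ 2 * (e * (8 * z ^ 2 + 1)) =
            (3 * u ^ 2 * quad2 c u + quad0 c u) * (9 * (1 + c) * quartic c u) / (2 * v) := by
          rw [mul_left_comm, mul_comm (v ^ 2), hw, he]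
          field_simp
        rw [e1, hydef, hzdef, paramY, paramZ, numer]
        field_simp
        rw [show v ^ 2 = discr c u from h, discr]
        ring
      exact mul_left_cancel₀ (pow_ne_zero 2 hv) h3
    rw [this]
    exact div_mem (sub_mem (add_mem hy (mul_mem (ofNat_mem F 32) (pow_mem hz 3)))
      (mul_mem (ofNat_mem F 4) hz)) hwF
  have hτF : τ ∈ F := by
    have : τ = (1 + c) * formA 1 z y / ((1 - c) * formB 1 z y * (8 * z ^ 2 + 1)) := by
      rw [eq_div_iff (mul_ne_zero (mul_ne_zero h2 hB0) hw0)]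
      have h3 : 8 * v ^ 9 * (τ * ((1 - c) * formB 1 z y * (8 * z ^ 2 + 1))) =
          8 * v ^ 9 * ((1 + c) * formA 1 z y) := by
        rw [show 8 * v ^ 9 * (τ * ((1 - c) * formB 1 z y * (8 * z ^ 2 + 1))) =
          2 * v * τ * (1 - c) * (4 * v ^ 6 * formB 1 z y) * ((8 * z ^ 2 + 1) * v ^ 2) by ring,
          hB, hw, show 8 * v ^ 9 * ((1 + c) * formA 1 z y) =
            (1 + c) * (8 * v ^ 9 * formA 1 z y) by ring, hA, hτ]
        field_simp
        ring
      exact mul_left_cancel₀ (mul_ne_zero (by norm_num) (pow_ne_zero 9 hv)) h3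
    rw [this]
    exact div_mem (mul_mem (add_mem (one_mem F) hc) hAF)
      (mul_mem (mul_mem (sub_mem (one_mem F) hc) hBF) hwF)
  have h6 : 6 * z ∈ F := by
    exact mul_mem (ofNat_mem F 6) hz
  have hd : (6 * z - (e + τ)) * (u * v) = 3 * quartic c u := by
    rw [hzdef, he, hτ, paramZ]
    field_simp
    simp only [quad0, quad1, quad2, quartic, quintic]
    ring
  have hd0 : 6 * z - (e + τ) ≠ 0 := by
    intro h0
    rw [h0, zero_mul] at hd
    exact mul_ne_zero three_ne_zero hquartic hd.symm
  have huF : u ∈ F := by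
    have : u = (e - τ - 6 * z) / (6 * z - (e + τ)) := by
      rw [eq_div_iff hd0, hzdef, he, hτ, paramZ]
      field_simp
      simp only [quad0, quad1, quad2, quintic]
      ring
    rw [this]
    exact div_mem (sub_mem (sub_mem heF hτF) h6) (sub_mem h6 (add_mem heF hτF))
  refine ⟨huF, ?_⟩
  have hz0 : z ≠ 0 := by
    rw [hzdef, paramZ]
    exact div_ne_zero hquad (mul_ne_zero two_ne_zero hv)
  have : v = quad1 c u / (2 * z) := by
    rw [eq_div_iff (mul_ne_zero two_ne_zero hz0), hzdef, paramZ]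
    field_simp
  rw [this]
  have h3 := ofNat_mem F 3
  exact div_mem (sub_mem (sub_mem (add_mem (pow_mem huF 3) (mul_mem h3 (pow_mem huF 2)))
    (mul_mem (mul_mem h3 hc) huF)) hc) (mul_mem (ofNat_mem F 2) hz)

end Generation

/-! ### The fibre over z = 0. -/

/-- The polynomial of the abscissas of the points of the curve over `z = 0`. -/
noncomputable def cubic (c : ℂ) : Polynomial ℂ :=
  Polynomial.X ^ 3 + Polynomial.C 3 * Polynomial.X ^ 2 + Polynomial.C (-3 * c) * Polynomial.X +
    Polynomial.C (-c)

theorem natDegree_cubic (c : ℂ) : (cubic c).natDegree = 3 := by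
  unfold cubic
  compute_degree!

theorem aeval_cubic {A : Type*} [CommRing A] [Algebra ℂ A] (c : ℂ) (u : A) :
    Polynomial.aeval u (cubic c) = quad1 (algebraMap ℂ A c) u := by
  simp only [cubic, quad1, map_add, map_mul, map_pow, map_neg, map_ofNat, Polynomial.aeval_C,
    Polynomial.aeval_X]
  ring

theorem aeval_branch_eq_discr {A : Type*} [CommRing A] [Algebra ℂ A] (c : ℂ) (u : A) :
    Polynomial.aeval u (branch c) = discr (algebraMap ℂ A c) u := by
  rw [aeval_branch]
  simp only [discr, quad0, quad1, quad2]
  ring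

theorem separable_cubic {c : ℂ} (h0 : c ≠ 0) (h1 : c ≠ -1) : (cubic c).Separable := by
  rw [Polynomial.Separable, Polynomial.isCoprime_iff_aeval_ne_zero_of_isAlgClosed ℂ ℂ]
  intro u
  by_contra! h
  obtain ⟨h2, h3⟩ := h
  rw [aeval_cubic, Algebra.algebraMap_self_apply, quad1] at h2
  rw [Polynomial.coe_aeval_eq_eval] at h3
  simp only [cubic, Polynomial.derivative_add, Polynomial.derivative_C_mul,
    Polynomial.derivative_X_pow, Polynomial.derivative_C, Polynomial.derivative_X,
    Polynomial.eval_add, Polynomial.eval_mul, Polynomial.eval_pow, Polynomial.eval_C,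
    Polynomial.eval_X, Polynomial.eval_one, Polynomial.eval_zero] at h3
  push_cast at h3
  have hc : c = u ^ 2 + 2 * u := by linear_combination (-1 / 3) * h3
  have h4 : u * (u + 1) ^ 2 = 0 := by
    rw [hc] at h2
    linear_combination (-1 / 2) * h2
  rcases mul_eq_zero.mp h4 with h5 | h5
  · exact h0 (by rw [hc, h5]; ring)
  · have h6 : u = -1 := by linear_combination pow_eq_zero_iff two_ne_zero |>.mp h5
    exact h1 (by rw [hc, h6]; ring)

theorem card_roots_cubic {c : ℂ} (h0 : c ≠ 0) (h1 : c ≠ -1) : (cubic c).roots.toFinset.card = 3 := by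
  rw [Multiset.toFinset_card_of_nodup (Polynomial.nodup_roots (separable_cubic h0 h1)),
    ← (IsAlgClosed.splits (cubic c)).natDegree_eq_card_roots, natDegree_cubic]

section Fibre

variable {a b c s : ℂ}

theorem ne_zero_of_quad1_eq_zero (h0 : c ≠ 0) (ha : quad1 c a = 0) : a ≠ 0 := by
  rintro rfl
  exact h0 (by simpa [quad1] using ha)

theorem ne_one_of_quad1_eq_zero (h1 : c ≠ 1) (ha : quad1 c a = 0) : a ≠ 1 := by
  rintro rfl
  exact h1 (by rw [quad1] at ha; linear_combination (-1 / 4) * ha)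

theorem quad2_ne_zero_of_quad1_eq_zero (h0 : c ≠ 0) (h1 : c ≠ -1) (ha : quad1 c a = 0) :
    quad2 c a ≠ 0 := by
  intro h
  have h3 : a * (1 + c) = 0 := by
    rw [quad1] at ha
    rw [quad2] at h
    linear_combination (1 / 3) * h - (1 / 3) * ha
  rcases mul_eq_zero.mp h3 with h4 | h4
  · exact ne_zero_of_quad1_eq_zero h0 ha h4
  · exact h1 (by linear_combination h4)

theorem quad0_eq_of_quad1_eq_zero (ha : quad1 c a = 0) : quad0 c a = -3 * a * quad2 c a := by
  have : quad0 c a + 3 * a * quad2 c a = 3 * (a + 1) * quad1 c a := by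
    simp only [quad0, quad1, quad2]
    ring
  rw [ha] at this
  linear_combination this

theorem discr_eq_of_quad1_eq_zero (ha : quad1 c a = 0) : discr c a = 3 * a * quad2 c a ^ 2 := by
  rw [discr, quad0_eq_of_quad1_eq_zero ha, ha]
  ring

theorem numer_eq_of_quad1_eq_zero (h0 : c ≠ 0) (ha : quad1 c a = 0) :
    numer c a = 9 * a * (a - 1) * quad2 c a ^ 3 := by
  have h1 : a * (9 * (1 + c) * quartic c a) = a * (3 * quad2 c a ^ 2) := by
    have h2 : a * (9 * (1 + c) * quartic c a) = 3 * quad1 c a ^ 2 - quad0 c a * quad2 c a := by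
      simp only [quartic, quad0, quad1, quad2]
      ring
    rw [h2, quad0_eq_of_quad1_eq_zero ha, ha]
    ring
  have h2 := mul_left_cancel₀ (ne_zero_of_quad1_eq_zero h0 ha) h1
  rw [numer, h2, quad0_eq_of_quad1_eq_zero ha, ha]
  ring

/-- Where `quad1` vanishes, `quad0` is -3a `quad2`, so the discriminant is 3a times a square and the
powers of `quad2` cancel in y². -/
theorem numer_sq_eq_of_quad1_eq_zero (h0 : c ≠ 0) (h1 : c ≠ -1) (ha : quad1 c a = 0)
    (hs : s ^ 2 = discr c a) : (numer c a / (2 * s ^ 3)) ^ 2 = 3 * (a - 1) ^ 2 / (4 * a) := by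
  have ha0 := ne_zero_of_quad1_eq_zero h0 ha
  have hq := quad2_ne_zero_of_quad1_eq_zero h0 h1 ha
  rw [div_pow, mul_pow, ← pow_mul, show s ^ (3 * 2) = (s ^ 2) ^ 3 by ring, hs,
    discr_eq_of_quad1_eq_zero ha, numer_eq_of_quad1_eq_zero h0 ha]
  field_simp
  ring

/-- The common value is (3/4)(a + 1/a - 2), so b = a or b = 1/a. If a and 1/a were both roots of the
cubic, then c² = 1 or a = -1/3, and -1/3 is never a root. -/
theorem eq_of_fibre_eq (h0 : c ≠ 0) (h1 : c ≠ 1) (h2 : c ≠ -1) (ha : quad1 c a = 0)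
    (hb : quad1 c b = 0) (h : 3 * (a - 1) ^ 2 / (4 * a) = 3 * (b - 1) ^ 2 / (4 * b)) : a = b := by
  have ha0 := ne_zero_of_quad1_eq_zero h0 ha
  have hb0 := ne_zero_of_quad1_eq_zero h0 hb
  have h3 : (a - b) * (a * b - 1) = 0 := by
    field_simp at h
    linear_combination h
  rcases mul_eq_zero.mp h3 with h4 | h4
  · exact sub_eq_zero.mp h4
  · exfalso
    have hab : b = a⁻¹ := by field_simp; linear_combination h4
    rw [hab] at hb
    simp only [quad1] at ha hb
    have hb' : 1 + 3 * a - 3 * c * a ^ 2 - c * a ^ 3 = 0 := by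
      field_simp at hb
      linear_combination hb
    -- `c (3a+1) = a²(a+3)` and `c a²(a+3) = 3a+1`
    have e1 : (c ^ 2 - 1) * (3 * a + 1) = 0 := by linear_combination (-c) * ha - hb'
    rcases mul_eq_zero.mp e1 with h5 | h5
    · have h6 : (c - 1) * (c + 1) = 0 := by linear_combination h5
      rcases mul_eq_zero.mp h6 with h7 | h7
      · exact h1 (by linear_combination h7)
      · exact h2 (by linear_combination h7)
    · have h6 : a = -1 / 3 := by linear_combination (1 / 3) * h5
      rw [h6] at ha
      norm_num at ha
      ring_nf at ha
      norm_num at ha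

/-- A parametrization of the curve near a point over `z = 0`. -/
theorem exists_place_of_quad1_eq_zero {K : Type*} [Field K] [Algebra ℂ K] {u v : K}
    (h : IsHyperelliptic (branch c) K u v) (h0 : c ≠ 0) (h1 : c ≠ -1) (ha : quad1 c a = 0)
    (hs : s ^ 2 = discr c a) (l : ℂ) : ∃ (σ : K →ₐ[ℂ] ℂ⸨X⸩) (Z Y : ℂ⟦X⟧),
      σ (paramZ (algebraMap ℂ K c) u v / algebraMap ℂ K l) = Z ∧
      σ (algebraMap ℂ K l * paramY (algebraMap ℂ K c) u v) = Y ∧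
      PowerSeries.constantCoeff Z = 0 ∧
      PowerSeries.constantCoeff Y = l * (numer c a / (2 * s ^ 3)) := by
  let U : ℂ⟦X⟧ := PowerSeries.C a + PowerSeries.X ^ 2
  have hU : PowerSeries.constantCoeff U = a := by simp [U]
  have hs0 : s ≠ 0 := by
    rintro rfl
    rw [discr_eq_of_quad1_eq_zero ha] at hs
    refine mul_ne_zero (mul_ne_zero three_ne_zero (ne_zero_of_quad1_eq_zero h0 ha))
      (pow_ne_zero 2 (quad2_ne_zero_of_quad1_eq_zero h0 h1 ha)) ?_
    rw [← hs]; ring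
  obtain ⟨W, hW⟩ := isSquare_aeval_of_isSquare_sub (LaurentSeries.isSquare_finiteParam_sub a)
    (branch c)
  rw [← sq] at hW
  have hWint : W ∈ LaurentSeries.integers := by
    apply LaurentSeries.mem_integers_of_sq
    rw [← hW]
    exact LaurentSeries.aeval_finiteParam_mem_integers a _
  obtain ⟨V', rfl⟩ := LaurentSeries.mem_integers.mp hWint
  have hV' : V' ^ 2 = discr (PowerSeries.C c) U := by
    apply HahnSeries.ofPowerSeries_injective (Γ := ℤ)
    rw [map_pow, ← hW, aeval_branch_eq_discr]
    simp only [discr, quad0, quad1, quad2, map_sub, map_add, map_mul, map_pow, map_ofNat,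
      LaurentSeries.algebraMap_eq_coe, LaurentSeries.finiteParam, U]
  have hc' : (PowerSeries.constantCoeff V') ^ 2 = s ^ 2 := by
    rw [← map_pow, hV', hs]
    simp only [discr, quad0, quad1, quad2, map_sub, map_add, map_mul, map_pow, map_ofNat, hU,
      PowerSeries.constantCoeff_C]
  -- The square root is only known up to sign; its sign is chosen so that the branch passes through
  -- the prescribed point (a, s).
  obtain ⟨V, hV, hcV⟩ : ∃ V : ℂ⟦X⟧, V ^ 2 = discr (PowerSeries.C c) U ∧
      PowerSeries.constantCoeff V = s := by
    rcases sq_eq_sq_iff_eq_or_eq_neg.mp hc' with h2 | h2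
    · exact ⟨V', hV', h2⟩
    · exact ⟨-V', by rw [neg_sq, hV'], by rw [map_neg, h2, neg_neg]⟩
  have hVU : ((V : ℂ⸨X⸩)) ^ 2 = Polynomial.aeval (LaurentSeries.finiteParam a) (branch c) := by
    rw [hW, ← map_pow, ← map_pow, hV, hV']
  obtain ⟨σ, hσu, hσv⟩ := h.exists_algHom _ _ (LaurentSeries.finiteParam_ne a) hVU
  have hVinv : V * V⁻¹ = 1 := PowerSeries.mul_inv_cancel V (by rw [hcV]; exact hs0)
  have hVinv' : ((V⁻¹ : ℂ⟦X⟧) : ℂ⸨X⸩) = ((V : ℂ⟦X⟧) : ℂ⸨X⸩)⁻¹ := by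
    apply eq_inv_of_mul_eq_one_left
    rw [← map_mul, mul_comm, hVinv, map_one]
  refine ⟨σ, PowerSeries.C (1 / (2 * l)) * quad1 (PowerSeries.C c) U * V⁻¹,
    PowerSeries.C (l / 2) * numer (PowerSeries.C c) U * V⁻¹ ^ 3, ?_, ?_, ?_, ?_⟩
  · rw [paramZ, map_div₀, map_div₀, map_mul, map_mul, map_mul, hVinv', hσv, σ.commutes]
    simp only [quad1, map_sub, map_add, map_mul, map_pow, map_ofNat, hσu, σ.commutes,
      ← LaurentSeries.algebraMap_eq_coe, LaurentSeries.finiteParam, U, map_div₀, map_one]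
    field_simp
  · rw [paramY, map_mul, map_div₀, map_mul, map_mul, map_mul, map_pow, map_pow, hVinv', hσv,
      σ.commutes]
    simp only [numer, quartic, quad0, quad1, quad2, map_sub, map_add, map_mul, map_pow, map_ofNat,
      hσu, σ.commutes, ← LaurentSeries.algebraMap_eq_coe, LaurentSeries.finiteParam, U, map_div₀,
      map_one]
    field_simp
  · rw [map_mul, map_mul]
    simp only [quad1, map_sub, map_add, map_mul, map_pow, map_ofNat, hU,
      PowerSeries.constantCoeff_C]
    rw [quad1] at ha
    rw [ha]
    ring
  · rw [map_mul, map_mul, map_pow, PowerSeries.constantCoeff_inv, hcV]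
    simp only [numer, quartic, quad0, quad1, quad2, map_sub, map_add, map_mul, map_pow, map_ofNat,
      hU, PowerSeries.constantCoeff_C, map_one]
    field_simp

end Fibre

/-- The curve has six distinct points over `z = 0`. -/
theorem exists_finset_fibre {c l : ℂ} (h0 : c ≠ 0) (h1 : c ≠ 1) (h2 : c ≠ -1) (hl : l ≠ 0) :
    ∃ T : Finset ℂ, T.card = 6 ∧ ∀ t ∈ T, ∃ a s : ℂ, quad1 c a = 0 ∧ s ^ 2 = discr c a ∧
      t = l * (numer c a / (2 * s ^ 3)) := by
  have hsq : ∀ a, ∃ s, s ^ 2 = discr c a := fun a => IsAlgClosed.exists_pow_nat_eq _ two_pos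
  choose s hs using hsq
  let R := (cubic c).roots.toFinset
  have hR : ∀ a ∈ R, quad1 c a = 0 := by
    intro a ha
    have h3 := (Polynomial.mem_roots'.mp (Multiset.mem_toFinset.mp ha)).2
    rwa [Polynomial.IsRoot, ← Polynomial.coe_aeval_eq_eval, aeval_cubic] at h3
  let η : ℂ → ℂ := fun a => l * (numer c a / (2 * s a ^ 3))
  have hη : ∀ a ∈ R, η a ^ 2 = l ^ 2 * (3 * (a - 1) ^ 2 / (4 * a)) := fun a ha => by
    rw [mul_pow, numer_sq_eq_of_quad1_eq_zero h0 h2 (hR a ha) (hs a)]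
  have hinj : ∀ a ∈ R, ∀ b ∈ R, η a ^ 2 = η b ^ 2 → a = b := by
    intro a ha b hb hab
    rw [hη a ha, hη b hb] at hab
    exact eq_of_fibre_eq h0 h1 h2 (hR a ha) (hR b hb) (mul_left_cancel₀ (pow_ne_zero 2 hl) hab)
  have hη0 : ∀ a ∈ R, η a ≠ 0 := by
    intro a ha h3
    have h4 := hη a ha
    have ha1 := sub_ne_zero.mpr (ne_one_of_quad1_eq_zero h1 (hR a ha))
    have ha0 := ne_zero_of_quad1_eq_zero h0 (hR a ha)
    rw [h3] at h4
    have h5 : l ^ 2 * (3 * (a - 1) ^ 2 / (4 * a)) ≠ 0 :=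
      mul_ne_zero (pow_ne_zero 2 hl) (div_ne_zero (mul_ne_zero three_ne_zero (pow_ne_zero 2 ha1))
        (mul_ne_zero (by norm_num) ha0))
    exact h5 (by rw [← h4]; ring)
  -- Each of the three roots of the cubic gives two opposite values of y. They are nonzero because a
  -- ≠ 1, and their squares distinguish the roots.
  refine ⟨R.image η ∪ R.image (fun a => -η a), ?_, ?_⟩
  · rw [Finset.card_union_of_disjoint, Finset.card_image_of_injOn, Finset.card_image_of_injOn,
      card_roots_cubic h0 h2]
    · intro a ha b hb hab
      exact hinj a ha b hb (by rw [neg_injective hab])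
    · intro a ha b hb hab
      exact hinj a ha b hb (by rw [hab])
    · rw [Finset.disjoint_left]
      intro t ht ht'
      obtain ⟨a, ha, rfl⟩ := Finset.mem_image.mp ht
      obtain ⟨b, hb, hab⟩ := Finset.mem_image.mp ht'
      have hba : b = a := hinj b hb a ha (by rw [← hab, neg_sq])
      subst hba
      exact hη0 b hb (self_eq_neg.mp hab.symm)
  · intro t ht
    rcases Finset.mem_union.mp ht with h | h
    · obtain ⟨a, ha, rfl⟩ := Finset.mem_image.mp h
      exact ⟨a, s a, hR a ha, hs a, rfl⟩
    · obtain ⟨a, ha, rfl⟩ := Finset.mem_image.mp h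
      refine ⟨a, -s a, hR a ha, by rw [neg_sq, hs], ?_⟩
      simp only [η]
      rw [Odd.neg_pow (by decide), mul_neg, div_neg, mul_neg]

end QuadraticSystem

/-! ### Vanishing ideals determined by a large fibre. -/

/-- If a point `(Z, Y)` specializes to `n` distinct points over `Z = 0`, then `Y` satisfies no
polynomial equation over `ℂ[Z]` of degree less than `n`. -/
theorem eq_zero_of_eval₂_eq_zero {L : Type*} [Field L] [Algebra ℂ L] {Z Y : L} (hZ : Z ≠ 0)
    (T : Finset ℂ) (hT : ∀ t ∈ T, ∃ (σ : L →ₐ[ℂ] ℂ⸨X⸩) (Z' Y' : ℂ⟦X⟧), σ Z = Z' ∧ σ Y = Y' ∧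
      PowerSeries.constantCoeff Z' = 0 ∧ PowerSeries.constantCoeff Y' = t)
    (r : Polynomial (Polynomial ℂ)) (hr : r.natDegree < T.card)
    (h : Polynomial.eval₂ (Polynomial.aeval Z).toRingHom Y r = 0) : r = 0 := by
  -- Descent on the degree in z of the leading coefficient: r vanishes modulo z, having more roots
  -- than its degree allows, and dividing by z lowers that degree by one.
  induction hn : r.leadingCoeff.natDegree using Nat.strong_induction_on generalizing r with
  | _ n ih =>
  have hmap : r.map (Polynomial.evalRingHom 0) = 0 := by
    refine Polynomial.eq_zero_of_natDegree_lt_card_of_eval_eq_zero' _ T ?_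
      (lt_of_le_of_lt Polynomial.natDegree_map_le hr)
    intro t ht
    obtain ⟨σ, Z', Y', hZ', hY', hcZ, hcY⟩ := hT t ht
    have h1 : Polynomial.eval₂ (Polynomial.aeval Z').toRingHom Y' r = 0 := by
      apply HahnSeries.ofPowerSeries_injective (Γ := ℤ)
      rw [map_zero, ← map_zero σ, ← h, Polynomial.hom_eval₂, ← AlgHom.coe_toRingHom σ,
        Polynomial.hom_eval₂, AlgHom.coe_toRingHom, hY']
      congr 1
      refine Polynomial.ringHom_ext (fun x => ?_) ?_
      · simp [LaurentSeries.algebraMap_eq_coe]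
      · simp [hZ']
    have h2 := congrArg PowerSeries.constantCoeff h1
    rw [Polynomial.hom_eval₂, map_zero, hcY] at h2
    have key : Polynomial.evalRingHom (0 : ℂ) =
        PowerSeries.constantCoeff.comp (Polynomial.aeval Z').toRingHom :=
      Polynomial.ringHom_ext (fun x => by simp) (by simp [hcZ])
    rw [Polynomial.eval_map, key]
    exact h2
  by_contra hr0
  have hdvd : Polynomial.C Polynomial.X ∣ r := by
    rw [Polynomial.C_dvd_iff_dvd_coeff]
    intro i
    rw [Polynomial.X_dvd_iff, Polynomial.coeff_zero_eq_eval_zero]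
    simpa using congrArg (fun p => Polynomial.coeff p i) hmap
  obtain ⟨r', rfl⟩ := hdvd
  have hr' : r' ≠ 0 := right_ne_zero_of_mul hr0
  have hC : (Polynomial.C Polynomial.X : Polynomial (Polynomial ℂ)) ≠ 0 := left_ne_zero_of_mul hr0
  rw [Polynomial.natDegree_C_mul Polynomial.X_ne_zero] at hr
  rw [Polynomial.eval₂_mul, Polynomial.eval₂_C] at h
  have h' := (mul_eq_zero.mp h).resolve_left (by simpa using hZ)
  rw [Polynomial.leadingCoeff_mul, Polynomial.leadingCoeff_C,
    Polynomial.natDegree_X_mul (Polynomial.leadingCoeff_ne_zero.mpr hr')] at hn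
  exact hr' (ih _ (by omega) r' hr h' rfl)

/-- A polynomial in `z` and `y` as a polynomial in `y` over `ℂ[z]`. -/
noncomputable def toIterated : MvPolynomial (Fin 2) ℂ →ₐ[ℂ] Polynomial (Polynomial ℂ) :=
  aeval ![Polynomial.C Polynomial.X, Polynomial.X]

theorem eval₂_toIterated {A : Type*} [CommRing A] [Algebra ℂ A] (Z Y : A)
    (h : MvPolynomial (Fin 2) ℂ) :
    Polynomial.eval₂ (Polynomial.aeval Z).toRingHom Y (toIterated h) = aeval ![Z, Y] h := by
  have key : (Polynomial.eval₂RingHom (Polynomial.aeval (R := ℂ) Z).toRingHom Y).comp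
      toIterated.toRingHom = (aeval (R := ℂ) ![Z, Y]).toRingHom := by
    refine MvPolynomial.ringHom_ext (fun a => ?_) (fun i => ?_)
    · simp [toIterated]
    · fin_cases i <;> simp [toIterated]
  exact congrArg (fun f => f h) key

/-- The vanishing ideal of a point whose fibre over `z = 0` is large enough is generated by any
monic equation of the right degree. -/
theorem dvd_of_aeval_eq_zero {L : Type*} [Field L] [Algebra ℂ L] {Z Y : L} (hZ : Z ≠ 0)
    (T : Finset ℂ) (hT : ∀ t ∈ T, ∃ (σ : L →ₐ[ℂ] ℂ⸨X⸩) (Z' Y' : ℂ⟦X⟧), σ Z = Z' ∧ σ Y = Y' ∧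
      PowerSeries.constantCoeff Z' = 0 ∧ PowerSeries.constantCoeff Y' = t)
    {g : MvPolynomial (Fin 2) ℂ} (hg : (toIterated g).Monic)
    (hdeg : (toIterated g).natDegree = T.card) (hdeg0 : T.card ≠ 0) (hgZ : aeval ![Z, Y] g = 0)
    {h : MvPolynomial (Fin 2) ℂ} (hhZ : aeval ![Z, Y] h = 0) : g ∣ h := by
  -- The remainder on division by g in y vanishes at (Z, Y) and has degree below the number of
  -- points of the fibre.
  have hr : toIterated h %ₘ toIterated g = 0 := by
    apply eq_zero_of_eval₂_eq_zero hZ T hT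
    · rw [← hdeg]
      exact Polynomial.natDegree_modByMonic_lt _ hg fun h1 => hdeg0 (by rw [← hdeg, h1]; simp)
    · rw [Polynomial.modByMonic_eq_sub_mul_div, Polynomial.eval₂_sub, Polynomial.eval₂_mul,
        eval₂_toIterated, eval₂_toIterated, hgZ, hhZ]
      simp
  have hdvd : toIterated g ∣ toIterated h := (Polynomial.modByMonic_eq_zero_iff_dvd hg).mp hr
  have h1 := map_dvd (Polynomial.eval₂RingHom
    (Polynomial.aeval (R := ℂ) (X 0 : MvPolynomial (Fin 2) ℂ)).toRingHom (X 1)) hdvd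
  rw [Polynomial.coe_eval₂RingHom, eval₂_toIterated, eval₂_toIterated] at h1
  have h2 : ![(X 0 : MvPolynomial (Fin 2) ℂ), X 1] = X := by
    ext i : 1
    fin_cases i <;> rfl
  rwa [h2, aeval_X_left, AlgHom.id_apply, AlgHom.id_apply] at h1

/-! ### Degree and invariance of g, and its parameters l and c. -/

namespace QuadraticSystem

theorem monic_toIterated_curve (p q : ℂ) :
    (toIterated (curve p q)).Monic ∧ (toIterated (curve p q)).natDegree = 6 := by
  have hC : ∀ a : ℂ, algebraMap ℂ (Polynomial (Polynomial ℂ)) a =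
      Polynomial.C (Polynomial.C a) := fun a => rfl
  simp only [toIterated, curve, map_add, map_sub, map_mul, map_neg, map_pow, algHom_C, aeval_X,
    hC, Matrix.cons_val_zero, Matrix.cons_val_one]
  constructor
  · monicity!
  · compute_degree!

/-- Restriction to the line y = 0 keeps the term in z¹⁸, whose coefficient is a multiple of q¹²;
this bounds the total degree from below. -/
theorem natDegree_aeval_curve {p q : ℂ} (hq : q ≠ 0) :
    (aeval ![Polynomial.X, 0] (curve p q) : Polynomial ℂ).natDegree = 18 := by
  have hC : ∀ a : ℂ, algebraMap ℂ (Polynomial ℂ) a = Polynomial.C a := fun a => rfl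
  simp only [curve, map_add, map_sub, map_mul, map_neg, map_pow, algHom_C, aeval_X,
    hC, Matrix.cons_val_zero, Matrix.cons_val_one]
  compute_degree!

theorem isInvariant_curve (p q : ℂ) :
    IsInvariantWithCofactor fieldZ (fieldY q) (curve p q) (18 * y) := by
  have h10 : (1 : Fin 2) ≠ 0 := by decide
  have h01 : (0 : Fin 2) ≠ 1 := by decide
  unfold IsInvariantWithCofactor
  apply MvPolynomial.funext
  intro x
  simp only [fieldZ, fieldY, curve, map_add, map_sub, map_mul, map_neg, map_pow, map_ofNat, map_one,
    Derivation.leibniz, Derivation.leibniz_pow, pderiv_C, pderiv_X_self, pderiv_X_of_ne h10,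
    pderiv_X_of_ne h01, smul_eq_mul, nsmul_eq_mul, map_natCast, map_zero, eval_C, eval_X]
  push_cast
  ring

theorem totalDegree_mul_pow_le {a : MvPolynomial (Fin 2) ℂ} {i : Fin 2} {k n : ℕ} (m : ℕ)
    (ha : a.totalDegree ≤ m) (h : m + k ≤ n) : (a * X i ^ k).totalDegree ≤ n := by
  refine (totalDegree_mul _ _).trans (le_trans (add_le_add ha ?_) h)
  rw [totalDegree_X_pow]

theorem totalDegree_mul_X_le {a : MvPolynomial (Fin 2) ℂ} {i : Fin 2} {n : ℕ} (m : ℕ)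
    (ha : a.totalDegree ≤ m) (h : m + 1 ≤ n) : (a * X i).totalDegree ≤ n := by
  refine (totalDegree_mul _ _).trans (le_trans (add_le_add ha ?_) h)
  rw [totalDegree_X]

theorem totalDegree_curve_le (p q : ℂ) : (curve p q).totalDegree ≤ 18 := by
  have hadd : ∀ {a b : MvPolynomial (Fin 2) ℂ} {n : ℕ}, a.totalDegree ≤ n → b.totalDegree ≤ n →
      (a + b).totalDegree ≤ n := fun ha hb => (totalDegree_add _ _).trans (max_le ha hb)
  have hsub : ∀ {a b : MvPolynomial (Fin 2) ℂ} {n : ℕ}, a.totalDegree ≤ n → b.totalDegree ≤ n →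
      (a - b).totalDegree ≤ n := fun ha hb => (totalDegree_sub _ _).trans (max_le ha hb)
  have hC : ∀ (a : ℂ) (n : ℕ), (C a : MvPolynomial (Fin 2) ℂ).totalDegree ≤ n := fun a n => by
    rw [totalDegree_C]; exact Nat.zero_le n
  have hnC : ∀ (a : ℂ) (n : ℕ), (-C a : MvPolynomial (Fin 2) ℂ).totalDegree ≤ n := fun a n => by
    rw [totalDegree_neg, totalDegree_C]; exact Nat.zero_le n
  have hp : ∀ (i : Fin 2) (n k : ℕ), n ≤ k → (X i ^ n : MvPolynomial (Fin 2) ℂ).totalDegree ≤ k :=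
    fun i n k h => by rwa [totalDegree_X_pow]
  have hCX : ∀ (a : ℂ) (i : Fin 2) (n k : ℕ), n ≤ k →
      (C a * X i ^ n : MvPolynomial (Fin 2) ℂ).totalDegree ≤ k :=
    fun a i n k h => totalDegree_mul_pow_le 0 (hC _ _) (by rwa [zero_add])
  have hnCX : ∀ (a : ℂ) (i : Fin 2) (n k : ℕ), n ≤ k →
      (-C a * X i ^ n : MvPolynomial (Fin 2) ℂ).totalDegree ≤ k :=
    fun a i n k h => totalDegree_mul_pow_le 0 (hnC _ _) (by rwa [zero_add])
  have hCX1 : ∀ (a : ℂ) (i : Fin 2) (k : ℕ), 1 ≤ k →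
      (C a * X i : MvPolynomial (Fin 2) ℂ).totalDegree ≤ k :=
    fun a i k h => totalDegree_mul_X_le 0 (hC _ _) h
  have hnCX1 : ∀ (a : ℂ) (i : Fin 2) (k : ℕ), 1 ≤ k →
      (-C a * X i : MvPolynomial (Fin 2) ℂ).totalDegree ≤ k :=
    fun a i k h => totalDegree_mul_X_le 0 (hnC _ _) h
  have hmul : ∀ {a : MvPolynomial (Fin 2) ℂ} {i : Fin 2} (k : ℕ), k ≤ 18 →
      a.totalDegree ≤ 18 - k → (a * X i ^ k).totalDegree ≤ 18 :=
    fun k hk ha => totalDegree_mul_pow_le _ ha (by omega)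
  have hmul1 : ∀ {a : MvPolynomial (Fin 2) ℂ} {i : Fin 2},
      a.totalDegree ≤ 17 → (a * X i).totalDegree ≤ 18 :=
    fun ha => totalDegree_mul_X_le _ ha le_rfl
  unfold curve
  repeat' with_reducible first
    | apply hadd
    | apply hsub
    | apply hC
    | apply hnC
    | apply hp
    | apply hCX
    | apply hnCX
    | apply hCX1
    | apply hnCX1
    | apply hmul
    | apply hmul1
  all_goals norm_num

theorem totalDegree_curve (p : ℂ) {q : ℂ} (hq : q ≠ 0) : (curve p q).totalDegree = 18 := by
  refine le_antisymm (totalDegree_curve_le p q) ?_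
  have h := aeval_natDegree_le (n := 1) (curve p q) le_rfl ![Polynomial.X, 0] (by
    intro i
    fin_cases i <;> simp)
  rwa [natDegree_aeval_curve hq, mul_one] at h

theorem isQuadratic_field (q : ℂ) : IsQuadratic fieldZ (fieldY q) := by
  have hadd : ∀ {a b : MvPolynomial (Fin 2) ℂ} {n : ℕ}, a.totalDegree ≤ n → b.totalDegree ≤ n →
      (a + b).totalDegree ≤ n := fun ha hb => (totalDegree_add _ _).trans (max_le ha hb)
  have hsub : ∀ {a b : MvPolynomial (Fin 2) ℂ} {n : ℕ}, a.totalDegree ≤ n → b.totalDegree ≤ n →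
      (a - b).totalDegree ≤ n := fun ha hb => (totalDegree_sub _ _).trans (max_le ha hb)
  have hC : ∀ (a : ℂ) (n : ℕ), (C a : MvPolynomial (Fin 2) ℂ).totalDegree ≤ n := fun a n => by
    rw [totalDegree_C]; exact Nat.zero_le n
  have hX : ∀ i : Fin 2, (X i : MvPolynomial (Fin 2) ℂ).totalDegree ≤ 1 := fun i => by
    rw [totalDegree_X]
  have hY : (fieldY q).totalDegree ≤ 2 := by
    refine hadd (hsub (hsub ?_ ?_) ?_) (hC _ _)
    · exact totalDegree_mul_pow_le 0 (hC 3 _) le_rfl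
    · exact totalDegree_mul_X_le 1 (totalDegree_mul_X_le 0 (hC _ _) le_rfl) le_rfl
    · exact totalDegree_mul_pow_le 0 (hC _ _) le_rfl
  have hZ : fieldZ.totalDegree ≤ 2 :=
    hadd (totalDegree_mul_X_le 1 (hX 0) le_rfl) (by rw [totalDegree_one]; exact Nat.zero_le 2)
  have hZ' : 2 ≤ fieldZ.totalDegree := by
    have h := aeval_natDegree_le (n := 1) fieldZ le_rfl ![Polynomial.X, Polynomial.X] (by
      intro i
      fin_cases i <;> simp)
    have h2 : (aeval ![Polynomial.X, Polynomial.X] fieldZ : Polynomial ℂ).natDegree = 2 := by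
      simp only [fieldZ, map_add, map_mul, map_one, aeval_X, Matrix.cons_val_zero,
        Matrix.cons_val_one]
      compute_degree!
    rwa [h2, mul_one] at h
  rw [IsQuadratic, le_antisymm hZ hZ', max_eq_left hY]

/-- The relation `hp` matches the ratio of the two pencil coefficients with the constant value of
A²/B³ on the parametrized curve. -/
theorem aeval_curve_param {M : Type*} [Field M] [Algebra ℂ M] [CharZero M] {p c l : ℂ} {u v : M}
    (hl : l ≠ 0) (hc : c ≠ 0) (hp : (p + 240 * l ^ 4) * c = -108 * l ^ 4 * (c - 1) ^ 2)
    (hv : v ≠ 0) (h : v ^ 2 = discr (algebraMap ℂ M c) u) :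
    aeval ![paramZ (algebraMap ℂ M c) u v / algebraMap ℂ M l,
      algebraMap ℂ M l * paramY (algebraMap ℂ M c) u v] (curve p (13 * l ^ 2)) = 0 := by
  have hB := formB_param hv h
  have hA := formA_param hv h
  have hp' := congrArg (algebraMap ℂ M) hp
  have hl' : algebraMap ℂ M l ≠ 0 := by simpa using hl
  have hc' : algebraMap ℂ M c ≠ 0 := by simpa using hc
  have hg := aeval_curve p (l ^ 2) ![paramZ (algebraMap ℂ M c) u v / algebraMap ℂ M l,
      algebraMap ℂ M l * paramY (algebraMap ℂ M c) u v]
  simp only [map_pow, Matrix.cons_val_zero, Matrix.cons_val_one, formB_scale hl',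
    formA_scale hl'] at hg
  simp only [map_add, map_sub, map_mul, map_pow, map_neg, map_ofNat, map_one] at hp'
  generalize formB 1 (paramZ (algebraMap ℂ M c) u v) (paramY (algebraMap ℂ M c) u v) = B at *
  generalize formA 1 (paramZ (algebraMap ℂ M c) u v) (paramY (algebraMap ℂ M c) u v) = A at *
  generalize aeval ![paramZ (algebraMap ℂ M c) u v / algebraMap ℂ M l,
    algebraMap ℂ M l * paramY (algebraMap ℂ M c) u v] (curve p (13 * l ^ 2)) = g at *
  generalize algebraMap ℂ M p = P at *
  generalize algebraMap ℂ M l = s at *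
  generalize algebraMap ℂ M c = d at *
  generalize quartic d u = a at *
  generalize quintic d u = b at *
  have h3 : 432 * 64 * s ^ 4 * d * v ^ 18 * g = 0 := by
    -- Since (d + 1)² - (d - 1)² = 4d and 432 = 4 · 108, the relation for p + 240l⁴ also gives the
    -- one for p - 192l⁴.
    have h4 : (P - 192 * s ^ 4) * d = -108 * s ^ 4 * (d + 1) ^ 2 := by linear_combination hp'
    have h5 : 432 * 64 * s ^ 4 * d * v ^ 18 * g =
        s ^ 6 * (((P + 240 * s ^ 4) * d) * (4 * v ^ 6 * B) ^ 3 -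
          ((P - 192 * s ^ 4) * d) * (8 * v ^ 9 * A) ^ 2) := by
      linear_combination 64 * d * v ^ 18 * hg
    rw [h5, hp', h4, hB, hA]
    ring
  have h6 : 432 * 64 * s ^ 4 * d * v ^ 18 ≠ 0 := by
    simp [hl', hc', hv]
  exact (mul_eq_zero.mp h3).resolve_left h6

/-- The scaling `l` and the modulus `c` of the hyperelliptic curve attached to `p` and `q`. -/
theorem exists_parameters {p q : ℂ} (hq : q ≠ 0) (h1 : p ≠ -(240 / 169) * q ^ 2)
    (h2 : p ≠ 192 / 169 * q ^ 2) : ∃ l c : ℂ, l ≠ 0 ∧ q = 13 * l ^ 2 ∧ c ≠ 0 ∧ c ≠ 1 ∧ c ≠ -1 ∧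
      (p + 240 * l ^ 4) * c = -108 * l ^ 4 * (c - 1) ^ 2 := by
  obtain ⟨l, hl⟩ := IsAlgClosed.exists_pow_nat_eq (q / 13) two_pos
  have hq' : q = 13 * l ^ 2 := by rw [hl]; ring
  have hl0 : l ≠ 0 := by
    rintro rfl
    exact hq (by rw [hq']; ring)
  -- The required relation expanded as a quadratic in c. Its values at 0, 1, -1 are 108l⁴, p + 240l⁴
  -- and 192l⁴ - p, so the hypotheses on p and q exclude exactly these roots.
  obtain ⟨c, hc⟩ := IsAlgClosed.exists_root
    (Polynomial.C (108 * l ^ 4) * Polynomial.X ^ 2 + Polynomial.C (p + 24 * l ^ 4) *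
      Polynomial.X + Polynomial.C (108 * l ^ 4)) (by
      have : (Polynomial.C (108 * l ^ 4) * Polynomial.X ^ 2 + Polynomial.C (p + 24 * l ^ 4) *
        Polynomial.X + Polynomial.C (108 * l ^ 4)).degree = 2 := by
        compute_degree!
      rw [this]
      decide)
  simp only [Polynomial.IsRoot, Polynomial.eval_add, Polynomial.eval_mul, Polynomial.eval_C,
    Polynomial.eval_pow,
    Polynomial.eval_X] at hc
  refine ⟨l, c, hl0, hq', ?_, ?_, ?_, by linear_combination hc⟩
  · rintro rfl
    simp [hl0] at hc
  · rintro rfl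
    exact h1 (by rw [hq']; linear_combination hc)
  · rintro rfl
    exact h2 (by rw [hq']; linear_combination -hc)

end QuadraticSystem

/-! ### Identification of g = 0 with the hyperelliptic curve. -/

namespace IsHyperelliptic

open QuadraticSystem

variable {K : Type*} [Field K] [Algebra ℂ K] {c : ℂ} {u v : K}

theorem sq_eq_discr (h : IsHyperelliptic (branch c) K u v) :
    v ^ 2 = discr (algebraMap ℂ K c) u := by
  rw [h.sq_eq, aeval_branch_eq_discr]

theorem coord_ne_zero {f : Polynomial ℂ} (h : IsHyperelliptic f K u v) : u ≠ 0 := by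
  simpa using h.aeval_ne_zero Polynomial.X Polynomial.X_ne_zero

theorem quad1_ne_zero (h : IsHyperelliptic (branch c) K u v) :
    quad1 (algebraMap ℂ K c) u ≠ 0 := by
  rw [← aeval_cubic]
  exact h.aeval_ne_zero _ (Polynomial.ne_zero_of_natDegree_gt (n := 0) (by simp [natDegree_cubic]))

theorem quartic_ne_zero (h : IsHyperelliptic (branch c) K u v) :
    quartic (algebraMap ℂ K c) u ≠ 0 := by
  have := h.aeval_ne_zero (Polynomial.X ^ 4 + Polynomial.C 2 * Polynomial.X ^ 3 +
    Polynomial.C (2 * c) * Polynomial.X + Polynomial.C c)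
    (Polynomial.Monic.ne_zero (by monicity!))
  simpa only [quartic, quintic, map_add, map_mul, map_pow, map_ofNat, Polynomial.aeval_C,
    Polynomial.aeval_X] using this

theorem quintic_ne_zero (h : IsHyperelliptic (branch c) K u v) :
    quintic (algebraMap ℂ K c) u ≠ 0 := by
  have := h.aeval_ne_zero (Polynomial.X ^ 5 + Polynomial.C 3 * Polynomial.X ^ 4 +
    Polynomial.C 2 * Polynomial.X ^ 3 + Polynomial.C (2 * c) * Polynomial.X ^ 2 +
    Polynomial.C (3 * c) * Polynomial.X + Polynomial.C c)
    (Polynomial.Monic.ne_zero (by monicity!))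
  simpa only [quartic, quintic, map_add, map_mul, map_pow, map_ofNat, Polynomial.aeval_C,
    Polynomial.aeval_X] using this

/-- A subfield containing the coordinates `z` and `y` of the parametrization is everything. -/
theorem eq_top_of_param_mem (h : IsHyperelliptic (branch c) K u v) (h1 : c ≠ 1) (h2 : c ≠ -1)
    (F : IntermediateField ℂ K) (hz : paramZ (algebraMap ℂ K c) u v ∈ F)
    (hy : paramY (algebraMap ℂ K c) u v ∈ F) : F = ⊤ := by
  have : CharZero K := charZero_of_injective_algebraMap (algebraMap ℂ K).injective
  have hf : branch c ≠ 0 := Polynomial.ne_zero_of_natDegree_gt (n := 0) (by simp [natDegree_branch])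
  obtain ⟨hu, hv⟩ := mem_of_param_mem F.toSubfield (h.ne_zero hf) h.sq_eq_discr h.coord_ne_zero
    (F.algebraMap_mem c)
    (fun h3 => h2 ((algebraMap ℂ K).injective (by
      rw [map_neg, map_one]; linear_combination h3)))
    (fun h3 => h1 ((algebraMap ℂ K).injective (by
      rw [map_one]; linear_combination -h3)))
    h.quad1_ne_zero h.quartic_ne_zero h.quintic_ne_zero hz hy
  have hpoly : ∀ a : Polynomial ℂ, Polynomial.aeval u a ∈ F := fun a =>
    Algebra.adjoin_le (S := F.toSubalgebra) (Set.singleton_subset_iff.mpr hu)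
      (Polynomial.aeval_mem_adjoin_singleton ℂ u)
  rw [eq_top_iff]
  rintro x -
  obtain ⟨a, s, b, r, -, -, -, -, rfl⟩ := h.exists_eq x
  exact F.add_mem (F.div_mem (hpoly a) (hpoly s)) (F.mul_mem (F.div_mem (hpoly b) (hpoly r)) hv)

/-- The vanishing ideal of the parametrization is generated by the equation of the curve. -/
theorem aeval_eq_zero_iff (h : IsHyperelliptic (branch c) K u v) {p l : ℂ} (hl : l ≠ 0)
    (h0 : c ≠ 0) (h1 : c ≠ 1) (h2 : c ≠ -1)
    (hp : (p + 240 * l ^ 4) * c = -108 * l ^ 4 * (c - 1) ^ 2) (x : MvPolynomial (Fin 2) ℂ) :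
    aeval ![paramZ (algebraMap ℂ K c) u v / algebraMap ℂ K l,
      algebraMap ℂ K l * paramY (algebraMap ℂ K c) u v] x = 0 ↔ curve p (13 * l ^ 2) ∣ x := by
  have : CharZero K := charZero_of_injective_algebraMap (algebraMap ℂ K).injective
  have hf : branch c ≠ 0 := Polynomial.ne_zero_of_natDegree_gt (n := 0) (by simp [natDegree_branch])
  have hv := h.ne_zero hf
  have hg := aeval_curve_param hl h0 hp hv h.sq_eq_discr
  have hl' : algebraMap ℂ K l ≠ 0 := by simpa using hl
  constructor
  · intro hx
    obtain ⟨T, hT, hT'⟩ := exists_finset_fibre h0 h1 h2 hl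
    obtain ⟨hm, hd⟩ := monic_toIterated_curve p (13 * l ^ 2)
    refine dvd_of_aeval_eq_zero ?_ T ?_ hm (by rw [hd, hT]) (by rw [hT]; decide) hg hx
    · exact div_ne_zero (div_ne_zero h.quad1_ne_zero (mul_ne_zero two_ne_zero hv)) hl'
    · intro t ht
      obtain ⟨a, s, ha, hs, rfl⟩ := hT' t ht
      exact exists_place_of_quad1_eq_zero h h0 h2 ha hs l
  · rintro ⟨w, rfl⟩
    rw [map_mul, hg, zero_mul]

/-- By `aeval_eq_zero_iff`, g generates the kernel of a ring homomorphism to a field. -/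
theorem prime_curve (h : IsHyperelliptic (branch c) K u v) {p l : ℂ} (hl : l ≠ 0)
    (h0 : c ≠ 0) (h1 : c ≠ 1) (h2 : c ≠ -1)
    (hp : (p + 240 * l ^ 4) * c = -108 * l ^ 4 * (c - 1) ^ 2) :
    Prime (curve p (13 * l ^ 2)) := by
  have key := h.aeval_eq_zero_iff hl h0 h1 h2 hp
  refine ⟨?_, ?_, ?_⟩
  · intro h3
    have h4 := (monic_toIterated_curve p (13 * l ^ 2)).1
    rw [h3, map_zero] at h4
    exact h4.ne_zero rfl
  · intro h3
    have h4 := (key 1).mpr h3.dvd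
    rw [map_one] at h4
    exact one_ne_zero h4
  · intro a b hab
    rw [← key, map_mul, mul_eq_zero, key, key] at hab
    exact hab

/-- The function field of the curve is the hyperelliptic field. -/
theorem planeCurveGenus_curve (h : IsHyperelliptic (branch c) K u v) {p l : ℂ} (hl : l ≠ 0)
    (h0 : c ≠ 0) (h1 : c ≠ 1) (h2 : c ≠ -1)
    (hp : (p + 240 * l ^ 4) * c = -108 * l ^ 4 * (c - 1) ^ 2)
    (hg : Irreducible (curve p (13 * l ^ 2))) :
    planeCurveGenus (curve p (13 * l ^ 2)) hg = 2 := by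
  unfold planeCurveGenus
  have := isPrime_of_irreducible hg
  have key := h.aeval_eq_zero_iff hl h0 h1 h2 hp
  have hl' : algebraMap ℂ K l ≠ 0 := by simpa using hl
  set g := curve p (13 * l ^ 2)
  set Z := paramZ (algebraMap ℂ K c) u v / algebraMap ℂ K l with hZ
  set Y := algebraMap ℂ K l * paramY (algebraMap ℂ K c) u v with hY
  let φ : MvPolynomial (Fin 2) ℂ ⧸ Ideal.span {g} →ₐ[ℂ] K :=
    Ideal.Quotient.liftₐ _ (aeval ![Z, Y]) fun x hx =>
      (key x).mpr (Ideal.mem_span_singleton.mp hx)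
  have hφ : Function.Injective φ := by
    rw [injective_iff_map_eq_zero]
    intro x hx
    obtain ⟨x, rfl⟩ := Ideal.Quotient.mk_surjective x
    exact Ideal.Quotient.eq_zero_iff_mem.mpr
      (Ideal.mem_span_singleton.mpr ((key x).mp hx))
  let ψ : FractionRing (MvPolynomial (Fin 2) ℂ ⧸ Ideal.span {g}) →ₐ[ℂ] K :=
    IsFractionRing.liftAlgHom hφ
  have hψ : ∀ x, aeval ![Z, Y] x ∈ ψ.fieldRange := fun x =>
    ⟨algebraMap _ _ (Ideal.Quotient.mk _ x), IsFractionRing.lift_algebraMap hφ _⟩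
  -- The image contains l and the scaled coordinates, hence the unscaled z and y, which generate K.
  have htop : ψ.fieldRange = ⊤ := by
    apply h.eq_top_of_param_mem h1 h2
    · have h3 := hψ (X 0 * C l)
      rw [map_mul, aeval_X, algHom_C, Matrix.cons_val_zero, hZ, div_mul_cancel₀ _ hl'] at h3
      exact h3
    · have h3 := ψ.fieldRange.div_mem (hψ (X 1)) (hψ (C l))
      rw [aeval_X, algHom_C, Matrix.cons_val_one, Matrix.cons_val_zero, hY,
        mul_div_cancel_left₀ _ hl'] at h3
      exact h3
  have hsurj : Function.Surjective ψ := fun x => by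
    have h3 : x ∈ ψ.fieldRange := by rw [htop]; trivial
    exact h3
  let e := (AlgEquiv.ofBijective ψ ⟨ψ.toRingHom.injective, hsurj⟩).symm
  exact (h.of_algEquiv e).finrank_regularDifferentials (separable_branch h0 h2)
    (separable_reverse_branch h0 h2) (natDegree_branch c)

end IsHyperelliptic

theorem mainTheorem4 (p q : ℂ) :
    QuadraticSystem.IsQuadratic QuadraticSystem.fieldZ (QuadraticSystem.fieldY q) ∧
    QuadraticSystem.IsInvariantWithCofactor QuadraticSystem.fieldZ (QuadraticSystem.fieldY q)
      (QuadraticSystem.curve p q) (18 * QuadraticSystem.y) ∧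
    (q ≠ 0 → (QuadraticSystem.curve p q).totalDegree = 18) ∧
    (q ≠ 0 → p ≠ -(240 / 169) * q ^ 2 → p ≠ 192 / 169 * q ^ 2 →
      ∃ hg : Irreducible (QuadraticSystem.curve p q),
        QuadraticSystem.planeCurveGenus (QuadraticSystem.curve p q) hg = 2) := by
  refine ⟨QuadraticSystem.isQuadratic_field q, QuadraticSystem.isInvariant_curve p q,
    QuadraticSystem.totalDegree_curve p, fun hq h1 h2 => ?_⟩
  obtain ⟨l, c, hl, rfl, h0, h1, h2, hp⟩ := QuadraticSystem.exists_parameters hq h1 h2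
  have : Fact (Irreducible (hyperellipticPolynomial (QuadraticSystem.branch c))) :=
    ⟨irreducible_hyperellipticPolynomial (QuadraticSystem.separable_branch h0 h2)
      (by rw [QuadraticSystem.natDegree_branch]; decide)⟩
  have h := HyperellipticField.isHyperelliptic (f := QuadraticSystem.branch c)
  exact ⟨(h.prime_curve hl h0 h1 h2 hp).irreducible,
    h.planeCurveGenus_curve hl h0 h1 h2 hp _⟩
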